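/- All graphs are finite and simple. For a graph $G$ and $X\subseteq V(G)$, $G\setminus X$ is the subgraph induced on $V(G)\setminus X$, and $N(X)$ is the set of vertices outside $X$ with a neighbour in $X$; induced subgraphs are identified with their vertex sets. A path may consist of a single vertex. A caterpillar is a tree $C$ of maximum degree three (exactly) that has a path containing all vertices of degree three of $C$. A subdivided star is a graph isomorphic to a subdivision of $K_{1,\delta}$ for some $\delta\ge 3$. A vertex $v$ of a graph $H$ is simplicial if its neighbourhood in $H$ is a clique; $\mathcal Z(H)$ is the set of simplicial vertices of $H$. **Theorem.** For every integer $h\ge 1$ there is an integer $\mu=\mu(h)\ge 1$ with the following property. Let $G$ be a connected graph and let $Y\subseteq V(G)$ be such that $|Y|\ge\mu$, $G\setminus Y$ is connected, and every vertex of $Y$ has a neighbour in $G\setminus Y$. Then there are a set $Y'\subseteq Y$ with $|Y'|=h$ and an induced subgraph $H$ of $G\setminus Y$ such that one of the following holds: 1. $H$ is a path and every vertex of $Y'$ has a neighbour in $H$; or 2. $H$ is a caterpillar, or the line graph of a caterpillar, or a subdivided star, or the line graph of a subdivided star; moreover, every vertex of $Y'$ has a unique neighbour in $H$, and $H\cap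 N(Y')=\mathcal Z(H)$. -/

import Mathlib

namespace Connectifier

/-- The graph `G` is a path: for some `k ≥ 1` it is isomorphic to the path on `k` vertices. A single
vertex is a path, the graph without vertices is not. -/
def IsPath {W : Type*} (G : SimpleGraph W) : Prop :=
  ∃ n : ℕ, Nonempty (G ≃g SimpleGraph.pathGraph (n + 1))

/-- A caterpillar: a tree of maximum degree (exactly) three with a path `P` that contains all its
vertices of degree three. -/
def IsCaterpillar {W : Type*} (C : SimpleGraph W) : Prop :=
  C.IsTree ∧
  ((∀ v, (C.neighborSet v).encard ≤ 3) ∧ ∃ v, (C.neighborSet v).encard = 3) ∧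
  ∃ P : Set W, IsPath (C.induce P) ∧ ∀ v, (C.neighborSet v).encard = 3 → v ∈ P

/-- The subdivision of the star `K_{1,δ}` in which the `i`-th edge is subdivided `l i` times.
The centre is `none`; the `i`-th leg has the `l i + 1` vertices `some ⟨i, 0⟩, …, some ⟨i, l i⟩`,
in this order starting from the neighbour of the centre. -/
def subdivStar {δ : ℕ} (l : Fin δ → ℕ) : SimpleGraph (Option (Σ i : Fin δ, Fin (l i + 1))) :=
  SimpleGraph.fromRel fun u v =>
    match u, v with
    | none, some ⟨_, a⟩ => (a : ℕ) = 0
    | some ⟨i, a⟩, some ⟨j, b⟩ => i = j ∧ (a : ℕ) + 1 = (b : ℕ)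
    | _, none => False

/-- A subdivided star: a graph isomorphic to a subdivision of `K_{1,δ}` for some `δ ≥ 3`. -/
def IsSubdividedStar {W : Type*} (S : SimpleGraph W) : Prop :=
  ∃ δ : ℕ, 3 ≤ δ ∧ ∃ l : Fin δ → ℕ, Nonempty (S ≃g subdivStar l)

/-- `H` is (isomorphic to) the line graph of a finite caterpillar. -/
def IsLineGraphOfCaterpillar {W : Type*} (H : SimpleGraph W) : Prop :=
  ∃ (n : ℕ) (C : SimpleGraph (Fin n)), IsCaterpillar C ∧ Nonempty (H ≃g C.lineGraph)

/-- `H` is (isomorphic to) the line graph of a subdivided star. -/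
def IsLineGraphOfSubdividedStar {W : Type*} (H : SimpleGraph W) : Prop :=
  ∃ δ : ℕ, 3 ≤ δ ∧ ∃ l : Fin δ → ℕ, Nonempty (H ≃g (subdivStar l).lineGraph)

/-- The set of simplicial vertices of `H`: the vertices whose neighbourhood is a clique. -/
def simplicialVertices {W : Type*} (H : SimpleGraph W) : Set W :=
  {v | H.IsClique (H.neighborSet v)}

end Connectifier

/-!
The proof passes to an inclusion-minimal set `S` of vertices outside `Y` that is connected and meets
the neighbourhood of every vertex of `Y`. Write `T` for the graph induced on `S`. If some vertex of
`T` has been chosen as a neighbour for `h` vertices of `Y`, it is a path as desired. Otherwise many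
vertices of `T` are marked, that is, chosen as neighbours of vertices of `Y`. By minimality, each
vertex of `T` that is not a cut vertex has a private neighbour in `Y`, which has no other neighbour
in `T` (`containsNoncut_of_minimal`). It therefore suffices to find an induced path through `h`
marked vertices, or a graph of one of the four types with `h` simplicial vertices, none of which is
a cut vertex of `T` (`exists_isPath_or_hasConnectifier`).

Fix a root `r` and say that `q` dominates `x` if every walk from `r` to `x` meets `q`. A vertex
dominated by `q` and different from `q` has all its neighbours among the vertices dominated by `q`,
and one at maximum distance from `r` is not a cut vertex. Hence every `q ≠ r` starts a leg, a
geodesic that leads to a non-cut vertex and that, apart from `q`, is anticomplete to everything not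
dominated by `q` (`ContainsNoncut.exists_leg`).

* If some vertex has large degree, it is taken as the root. By Ramsey's theorem it has `h` neighbours
  that form a clique or an independent set; with their legs they form the line graph of a subdivided
  star, or, together with the root, a subdivided star (`hasConnectifier_of_degree`).
* If all degrees are bounded, the root is chosen to be a non-cut vertex. A geodesic that moves away
  from the root, always towards the most marked vertices, contains many marked vertices or has many
  vertices `s j` with a second neighbour `q j` on the next distance level
  (`exists_geodesic_events`). In the latter case, indices `j` at mutual distance at least three are
  kept. The vertex `q j` can only be adjacent to `s j`, `s (j + 1)` and `s (j + 2)`. If it is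
  adjacent to `s j` only, the legs yield a caterpillar; if it is adjacent to `s j` and `s (j + 1)`
  only, the line graph of one. If it is adjacent to `s (j + 2)`, the geodesic is rerouted through
  `q j`; then either the remaining parts of the legs hang off the new geodesic and yield a
  caterpillar, or the vertices `q j` are themselves not cut vertices, hence marked, and the new
  geodesic is the path. Both ends of the geodesic are non-cut vertices, so they may serve as
  simplicial vertices.

The four types are recognized through rooted trees given by parent functions: the line graph of such
a tree is the graph on the vertices other than the root in which parents and siblings are adjacent
(`exists_iso_lineGraph_treeOf`), and distance levels reduce the verification that a map is an
embedding to adjacencies that do not increase the level (`exists_embedding_treeOf`,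
`exists_embedding_sibGraph`).
-/

namespace Connectifier

open SimpleGraph

/-! ### Rooted trees and their line graphs -/

/-- The graph on `Option α` in which every `a : α` is joined to its parent `p a`. The extra vertex
`none` is the root. -/
def treeOf {α : Type*} (p : α → Option α) : SimpleGraph (Option α) where
  Adj u v := u ≠ v ∧ ((∃ a, u = some a ∧ p a = v) ∨ ∃ a, v = some a ∧ p a = u)
  symm := ⟨fun _ _ h => ⟨h.1.symm, h.2.symm⟩⟩
  loopless := ⟨fun _ h => h.1 rfl⟩

/-- The graph on `α` in which `a` is joined to its parent and to its siblings. Identifying `a` with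
the edge from `a` to `p a`, this is the line graph of `treeOf p`. -/
def sibGraph {α : Type*} (p : α → Option α) : SimpleGraph α where
  Adj a b := a ≠ b ∧ (p a = some b ∨ p b = some a ∨ p a = p b)
  symm := ⟨fun _ _ h => ⟨h.1.symm, by rcases h.2 with h | h | h <;> simp [h]⟩⟩
  loopless := ⟨fun _ h => h.1 rfl⟩

section Rooted

variable {α : Type*} {p : α → Option α} {ρ : α → ℕ}

theorem parent_ne (hρ : ∀ a b, p a = some b → ρ b < ρ a) (a : α) : p a ≠ some a :=
  fun h => lt_irrefl _ (hρ a a h)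

theorem treeOf_adj_parent (hρ : ∀ a b, p a = some b → ρ b < ρ a) (a : α) :
    (treeOf p).Adj (some a) (p a) :=
  ⟨fun h => parent_ne hρ a h.symm, Or.inl ⟨a, rfl, rfl⟩⟩

theorem parent_asymm (hρ : ∀ a b, p a = some b → ρ b < ρ a) {a b : α} (h : p a = some b) :
    p b ≠ some a :=
  fun h' => lt_asymm (hρ _ _ h) (hρ _ _ h')

/-- The edges of a rooted tree correspond to its vertices other than the root. -/
theorem exists_iso_lineGraph_treeOf (hρ : ∀ a b, p a = some b → ρ b < ρ a) :
    Nonempty (sibGraph p ≃g (treeOf p).lineGraph) := by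
  let f : α → (treeOf p).edgeSet := fun a => ⟨s(some a, p a), treeOf_adj_parent hρ a⟩
  have hinj : Function.Injective f := by
    intro a b hab
    have := congrArg Subtype.val hab
    simp only [f, Sym2.eq_iff, Option.some.injEq] at this
    rcases this with h | ⟨h1, h2⟩
    · exact h.1
    · exact absurd h1.symm (parent_asymm hρ h2)
  have hsurj : Function.Surjective f := by
    rintro ⟨e, he⟩
    induction e with
    | _ u v =>
      rcases he.2 with ⟨a, rfl, rfl⟩ | ⟨a, rfl, rfl⟩
      · exact ⟨a, rfl⟩
      · exact ⟨a, Subtype.ext Sym2.eq_swap⟩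
  refine ⟨⟨Equiv.ofBijective f ⟨hinj, hsurj⟩, ?_⟩⟩
  intro a b
  change (f a ≠ f b ∧ ((f a : Set (Option α)) ∩ (f b : Set (Option α))).Nonempty) ↔ _
  rw [hinj.ne_iff]
  refine and_congr_right fun hab => ?_
  simp only [f, Set.Nonempty, Set.mem_inter_iff, SetLike.mem_coe, Sym2.mem_iff]
  constructor
  · rintro ⟨x, rfl | rfl, h | h⟩
    · simp_all
    · exact Or.inr (Or.inl h.symm)
    · exact Or.inl h
    · exact Or.inr (Or.inr h)
  · rintro (h | h | h)
    · exact ⟨p a, Or.inr rfl, Or.inl h⟩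
    · exact ⟨p b, Or.inl h, Or.inr rfl⟩
    · exact ⟨p a, Or.inr rfl, Or.inr h⟩

theorem treeOf_reachable_root (hρ : ∀ a b, p a = some b → ρ b < ρ a) (v : Option α) :
    (treeOf p).Reachable v none := by
  have key : ∀ n, ∀ a, ρ a ≤ n → (treeOf p).Reachable (some a) none := by
    intro n
    induction n with
    | zero =>
      intro a ha
      have h1 := (treeOf_adj_parent hρ a).reachable
      rcases hpa : p a with _ | b
      · rwa [hpa] at h1
      · have := hρ a b hpa
        omega
    | succ n ih =>
      intro a ha
      have h1 := (treeOf_adj_parent hρ a).reachable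
      rcases hpa : p a with _ | b
      · rwa [hpa] at h1
      · have := hρ a b hpa
        rw [hpa] at h1
        exact h1.trans (ih b (by omega))
  cases v with
  | none => exact Reachable.refl _
  | some a => exact key _ a le_rfl

theorem isTree_treeOf [Finite α] (hρ : ∀ a b, p a = some b → ρ b < ρ a) : (treeOf p).IsTree := by
  rw [isTree_iff_connected_and_card]
  refine ⟨⟨fun u v => (treeOf_reachable_root hρ u).trans (treeOf_reachable_root hρ v).symm⟩, ?_⟩
  obtain ⟨e⟩ := exists_iso_lineGraph_treeOf hρ
  rw [← Nat.card_congr e.toEquiv, Finite.card_option]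

theorem mem_simplicialVertices_iff {W : Type*} {H : SimpleGraph W} {v : W} :
    v ∈ simplicialVertices H ↔ ∀ x y, H.Adj v x → H.Adj v y → x ≠ y → H.Adj x y :=
  ⟨fun h _ _ hx hy => h hx hy, fun h _ hx _ hy => h _ _ hx hy⟩

theorem some_mem_simplicialVertices_treeOf (hρ : ∀ a b, p a = some b → ρ b < ρ a) {a : α} :
    some a ∈ simplicialVertices (treeOf p) ↔ ∀ b, p b ≠ some a := by
  rw [mem_simplicialVertices_iff]
  constructor
  · intro h b hb
    have h1 := treeOf_adj_parent hρ a
    have h2 := treeOf_adj_parent hρ b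
    rw [hb] at h2
    have hne : p a ≠ some b := parent_asymm hρ hb
    have h3 := h _ _ h1 h2.symm hne
    rcases h3.2 with ⟨c, hc, hc'⟩ | ⟨c, hc, hc'⟩
    · have e1 := hρ _ _ hb
      have e2 := hρ _ _ hc
      have e3 := hρ _ _ hc'
      omega
    · obtain rfl := Option.some.inj hc
      rw [hb] at hc'
      exact parent_ne hρ a hc'.symm
  · intro h x y hx hy hxy
    have aux : ∀ z, (treeOf p).Adj (some a) z → z = p a := by
      rintro z ⟨-, ⟨c, hc, hc'⟩ | ⟨c, hc, hc'⟩⟩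
      · rw [← hc', Option.some.inj hc]
      · exact absurd hc' (h c)
    exact absurd ((aux x hx).trans (aux y hy).symm) hxy

theorem none_mem_simplicialVertices_treeOf :
    none ∈ simplicialVertices (treeOf p) ↔ ∀ a b, p a = none → p b = none → a = b := by
  have aux : ∀ z, (treeOf p).Adj none z ↔ ∃ a, z = some a ∧ p a = none := by
    intro z
    simp only [treeOf]
    constructor
    · rintro ⟨-, ⟨c, hc, hc'⟩ | ⟨c, hc, hc'⟩⟩
      · exact absurd hc (by simp)
      · exact ⟨c, hc, hc'⟩
    · rintro ⟨a, rfl, ha⟩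
      exact ⟨by simp, Or.inr ⟨a, rfl, ha⟩⟩
  rw [mem_simplicialVertices_iff]
  constructor
  · intro h a b ha hb
    by_contra hab
    have := h _ _ ((aux _).2 ⟨a, rfl, ha⟩) ((aux _).2 ⟨b, rfl, hb⟩) (by simpa using hab)
    rcases this.2 with ⟨c, hc, hc'⟩ | ⟨c, hc, hc'⟩
    · rw [← Option.some.inj hc, ha] at hc'
      simp at hc'
    · rw [← Option.some.inj hc, hb] at hc'
      simp at hc'
  · intro h x y hx hy hxy
    obtain ⟨a, rfl, ha⟩ := (aux _).1 hx
    obtain ⟨b, rfl, hb⟩ := (aux _).1 hy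
    exact absurd (congrArg some (h a b ha hb)) hxy

theorem mem_simplicialVertices_sibGraph (hρ : ∀ a b, p a = some b → ρ b < ρ a) {a : α} :
    a ∈ simplicialVertices (sibGraph p) ↔
      (∀ b, p b ≠ some a) ∨ (p a = none ∧ ∀ b, p b = none → b = a) := by
  rw [mem_simplicialVertices_iff]
  constructor
  · intro h
    by_contra hcon
    push Not at hcon
    obtain ⟨⟨b, hb⟩, hroot⟩ := hcon
    have hab : (sibGraph p).Adj a b := ⟨fun e => parent_ne hρ b (e ▸ hb), Or.inr (Or.inl hb)⟩
    have e1 := hρ _ _ hb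
    rcases hpa : p a with _ | c
    · obtain ⟨c, hc, hca⟩ := hroot hpa
      have hac : (sibGraph p).Adj a c := ⟨hca.symm, Or.inr (Or.inr (by rw [hpa, hc]))⟩
      have hbc : b ≠ c := by
        rintro rfl
        rw [hb] at hc
        simp at hc
      rcases (h _ _ hab hac hbc).2 with h' | h' | h'
      · exact hca (Option.some.inj (h'.symm.trans hb))
      · rw [hc] at h'
        simp at h'
      · rw [hc, hb] at h'
        simp at h'
    · have e2 := hρ _ _ hpa
      have hac : (sibGraph p).Adj a c := ⟨fun e => parent_ne hρ a (e ▸ hpa), Or.inl hpa⟩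
      have hbc : b ≠ c := by
        rintro rfl
        omega
      rcases (h _ _ hab hac hbc).2 with h' | h' | h'
      · have := Option.some.inj (h'.symm.trans hb)
        subst this
        omega
      · have := hρ _ _ h'
        omega
      · rw [hb] at h'
        have := hρ _ _ h'.symm
        omega
  · rintro (h | ⟨h1, h2⟩) x y hx hy hxy
    · have aux : ∀ z, (sibGraph p).Adj a z → p a = some z ∨ p z = p a := by
        rintro z ⟨-, h' | h' | h'⟩
        · exact Or.inl h'
        · exact absurd h' (h z)
        · exact Or.inr h'.symm
      rcases aux x hx with hx | hx <;> rcases aux y hy with hy | hy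
      · exact absurd (Option.some.inj (hx.symm.trans hy)) hxy
      · exact ⟨hxy, Or.inr (Or.inl (hy.trans hx))⟩
      · exact ⟨hxy, Or.inl (hx.trans hy)⟩
      · exact ⟨hxy, Or.inr (Or.inr (hx.trans hy.symm))⟩
    · have aux : ∀ z, (sibGraph p).Adj a z → p z = some a := by
        rintro z ⟨hz, h' | h' | h'⟩
        · rw [h1] at h'
          simp at h'
        · exact h'
        · exact absurd (h2 z (h'.symm.trans h1)).symm hz
      exact ⟨hxy, Or.inr (Or.inr ((aux x hx).trans (aux y hy).symm))⟩

/-- To embed a rooted tree into a graph with a level function, it suffices that parents are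
mapped to neighbours and that every vertex has no neighbour in the image at its own level or
below except for its parent. -/
theorem exists_embedding_treeOf {U : Type*} {T : SimpleGraph U} (d : U → ℕ) (g : Option α → U)
    (hinj : Function.Injective g)
    (hroot : ∀ a, d (g none) ≤ d (g (some a)))
    (hadj : ∀ a, T.Adj (g (some a)) (g (p a)))
    (hdown : ∀ a u, T.Adj (g (some a)) (g u) → d (g u) ≤ d (g (some a)) → p a = u) :
    ∃ f : treeOf p ↪g T, ∀ v, f v = g v := by
  refine ⟨⟨⟨g, hinj⟩, ?_⟩, fun _ => rfl⟩
  have key : ∀ u v, T.Adj (g u) (g v) → d (g v) ≤ d (g u) → (treeOf p).Adj u v := by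
    intro u v h hle
    have hne : u ≠ v := fun e => h.ne (congrArg g e)
    cases u with
    | some a => exact ⟨hne, Or.inl ⟨a, rfl, hdown a v h hle⟩⟩
    | none =>
      cases v with
      | none => exact absurd rfl hne
      | some b => exact ⟨hne, Or.inr ⟨b, rfl, hdown b none h.symm (hroot b)⟩⟩
  intro u v
  change T.Adj (g u) (g v) ↔ _
  constructor
  · intro h
    rcases le_total (d (g v)) (d (g u)) with hle | hle
    · exact key u v h hle
    · exact (key v u h.symm hle).symm
  · rintro ⟨-, ⟨a, rfl, rfl⟩ | ⟨a, rfl, rfl⟩⟩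
    · exact hadj a
    · exact (hadj a).symm

/-- The analogue of `exists_embedding_treeOf` for line graphs of rooted trees. -/
theorem exists_embedding_sibGraph {U : Type*} {T : SimpleGraph U} (d : U → ℕ) (g : α → U)
    (hinj : Function.Injective g)
    (hadj : ∀ a b, p a = some b → T.Adj (g a) (g b))
    (hsib : ∀ a b, a ≠ b → p a = p b → T.Adj (g a) (g b))
    (hdown : ∀ a b, T.Adj (g a) (g b) → d (g b) ≤ d (g a) → p a = some b ∨ p a = p b) :
    ∃ f : sibGraph p ↪g T, ∀ v, f v = g v := by
  refine ⟨⟨⟨g, hinj⟩, ?_⟩, fun _ => rfl⟩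
  intro u v
  change T.Adj (g u) (g v) ↔ _
  constructor
  · intro h
    refine ⟨fun e => h.ne (congrArg g e), ?_⟩
    rcases le_total (d (g v)) (d (g u)) with hle | hle
    · rcases hdown u v h hle with h' | h'
      · exact Or.inl h'
      · exact Or.inr (Or.inr h')
    · rcases hdown v u h.symm hle with h' | h'
      · exact Or.inr (Or.inl h')
      · exact Or.inr (Or.inr h'.symm)
  · rintro ⟨hne, h | h | h⟩
    · exact hadj _ _ h
    · exact (hadj _ _ h).symm
    · exact hsib _ _ hne h

end Rooted

/-! ### Paths, caterpillars and stars as explicit graphs -/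

theorem isPath_induce_image {U : Type*} {T : SimpleGraph U} {n : ℕ} {s : ℕ → U}
    (hinj : ∀ i j, i ≤ n → j ≤ n → s i = s j → i = j)
    (hadj : ∀ i j, i < j → j ≤ n → (T.Adj (s i) (s j) ↔ i + 1 = j)) :
    IsPath (T.induce (s '' Set.Iic n)) := by
  let f : pathGraph (n + 1) ↪g T :=
    ⟨⟨fun i => s i, fun i j h => Fin.ext (hinj i j (by omega) (by omega) h)⟩, by
      intro i j
      change T.Adj (s i) (s j) ↔ _
      rw [pathGraph_adj]
      rcases lt_trichotomy (i : ℕ) j with h | h | h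
      · rw [hadj i j h (by omega)]
        omega
      · rw [h]
        simp
      · rw [T.adj_comm, hadj j i h (by omega)]
        omega⟩
  have hr : s '' Set.Iic n = Set.range f := by
    ext x
    constructor
    · rintro ⟨i, hi, rfl⟩
      exact ⟨⟨i, Nat.lt_succ_of_le hi⟩, rfl⟩
    · rintro ⟨i, rfl⟩
      exact ⟨i, Nat.le_of_lt_succ i.2, rfl⟩
  rw [hr]
  exact ⟨n, ⟨f.isoInduceRange.symm⟩⟩

theorem encard_neighborSet_congr {V W : Type*} {G : SimpleGraph V} {H : SimpleGraph W}
    (e : G ≃g H) (v : V) : (H.neighborSet (e v)).encard = (G.neighborSet v).encard := by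
  have : H.neighborSet (e v) = e '' G.neighborSet v := by
    ext x
    constructor
    · intro hx
      refine ⟨e.symm x, ?_, e.apply_symm_apply x⟩
      have hx' : H.Adj (e v) (e (e.symm x)) := by rwa [e.apply_symm_apply]
      exact e.map_adj_iff.1 hx'
    · rintro ⟨y, hy, rfl⟩
      exact e.map_adj_iff.2 hy
  rw [this, e.injective.encard_image]

theorem isPath_congr {V W : Type*} {G : SimpleGraph V} {H : SimpleGraph W} (e : G ≃g H)
    (h : IsPath G) : IsPath H := by
  obtain ⟨n, ⟨f⟩⟩ := h
  exact ⟨n, ⟨e.symm.trans f⟩⟩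

theorem isCaterpillar_congr {V W : Type*} {G : SimpleGraph V} {H : SimpleGraph W} (e : G ≃g H)
    (h : IsCaterpillar G) : IsCaterpillar H := by
  obtain ⟨ht, ⟨h3, v, hv⟩, P, hP, hP3⟩ := h
  refine ⟨(Iso.isTree_iff e).1 ht, ⟨fun w => ?_, e v, ?_⟩, e '' P, ?_, fun w hw => ?_⟩
  · rw [← e.apply_symm_apply w, encard_neighborSet_congr]
    exact h3 _
  · rw [encard_neighborSet_congr, hv]
  · refine isPath_congr ⟨e.toEquiv.image P, ?_⟩ hP
    rintro ⟨a, ha⟩ ⟨b, hb⟩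
    exact e.map_adj_iff
  · rw [← e.apply_symm_apply w, encard_neighborSet_congr] at hw
    exact ⟨_, hP3 _ hw, e.apply_symm_apply w⟩

theorem isLineGraphOfCaterpillar_sibGraph {α : Type*} [Finite α] {p : α → Option α} {ρ : α → ℕ}
    (hρ : ∀ a b, p a = some b → ρ b < ρ a) (h : IsCaterpillar (treeOf p)) :
    IsLineGraphOfCaterpillar (sibGraph p) := by
  obtain ⟨e⟩ := exists_iso_lineGraph_treeOf hρ
  have := Fintype.ofFinite (Option α)
  have i := (treeOf p).overFinIso rfl
  exact ⟨_, _, isCaterpillar_congr i h, ⟨e.trans i.lineGraph⟩⟩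

/-- The parent function of the subdivided star with legs of `l i + 1` vertices. -/
def starParent {δ : ℕ} (l : Fin δ → ℕ) :
    (Σ i : Fin δ, Fin (l i + 1)) → Option (Σ i : Fin δ, Fin (l i + 1))
  | ⟨_, ⟨0, _⟩⟩ => none
  | ⟨i, ⟨b + 1, h⟩⟩ => some ⟨i, ⟨b, by omega⟩⟩

theorem starParent_zero {δ : ℕ} (l : Fin δ → ℕ) (i : Fin δ) : starParent l ⟨i, 0⟩ = none :=
  rfl

theorem starParent_rank {δ : ℕ} (l : Fin δ → ℕ) (u v : Σ i : Fin δ, Fin (l i + 1))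
    (h : starParent l u = some v) : (v.2 : ℕ) < u.2 := by
  obtain ⟨i, ⟨_ | b, hb⟩⟩ := u
  · simp [starParent] at h
  · simp only [starParent, Option.some.injEq] at h
    subst h
    simp

theorem treeOf_starParent {δ : ℕ} (l : Fin δ → ℕ) : treeOf (starParent l) = subdivStar l := by
  have key : ∀ u v, (∃ a, u = some a ∧ starParent l a = v) ↔
      (match v, u with
        | none, some ⟨_, a⟩ => (a : ℕ) = 0
        | some ⟨i, a⟩, some ⟨j, b⟩ => i = j ∧ (a : ℕ) + 1 = (b : ℕ)
        | _, none => False) := by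
    rintro (_ | ⟨i, ⟨_ | a, ha⟩⟩) (_ | ⟨j, ⟨b, hb⟩⟩)
    · simp
    · simp
    · simp [starParent_zero]
    · simp [starParent_zero]
    · simp [starParent]
    · simp only [Option.some.injEq, exists_eq_left', starParent]
      constructor
      · rintro h
        obtain ⟨rfl, h⟩ := Sigma.mk.inj_iff.1 h
        obtain rfl := Fin.mk.inj_iff.1 (eq_of_heq h)
        exact ⟨rfl, rfl⟩
      · rintro ⟨rfl, h⟩
        obtain rfl : b = a := by simpa using h
        rfl
  ext u v
  simp only [treeOf, subdivStar, fromRel_adj, key]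
  exact and_congr_right fun _ => or_comm

theorem starParent_ne_some {δ : ℕ} (l : Fin δ → ℕ) (v : Σ i : Fin δ, Fin (l i + 1)) :
    (∀ u, starParent l u ≠ some v) ↔ ∃ i, v = ⟨i, Fin.last (l i)⟩ := by
  obtain ⟨i, b⟩ := v
  constructor
  · intro h
    refine ⟨i, ?_⟩
    by_contra hne
    have hb : (b : ℕ) ≠ l i := fun e => hne (by
      obtain rfl : b = Fin.last (l i) := Fin.ext e
      rfl)
    exact h ⟨i, ⟨b + 1, by omega⟩⟩ rfl
  · rintro ⟨j, hj⟩ ⟨i', ⟨_ | b', hb'⟩⟩ hu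
    · simp [starParent] at hu
    · rw [hj] at hu
      simp only [starParent, Option.some.injEq] at hu
      obtain ⟨rfl, h⟩ := Sigma.mk.inj_iff.1 hu
      have := Fin.mk.inj_iff.1 (eq_of_heq h)
      omega

/-- The parent function of a caterpillar. The spine consists of the root `none` and of the vertices
`inl 0, …, inl n`, in this order; the leg `inr ⟨i, 0⟩, …, inr ⟨i, l i⟩` is attached to the spine
vertex `inl (a i)`. -/
def catParent {n k : ℕ} (a : Fin k → Fin n) (l : Fin k → ℕ) :
    Fin (n + 1) ⊕ (Σ i : Fin k, Fin (l i + 1)) → Option (Fin (n + 1) ⊕ (Σ i : Fin k, Fin (l i + 1)))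
  | .inl ⟨0, _⟩ => none
  | .inl ⟨j + 1, h⟩ => some (.inl ⟨j, by omega⟩)
  | .inr ⟨i, ⟨0, _⟩⟩ => some (.inl (a i).castSucc)
  | .inr ⟨i, ⟨b + 1, h⟩⟩ => some (.inr ⟨i, ⟨b, by omega⟩⟩)

section Caterpillar

variable {n k : ℕ} {a : Fin k → Fin n} {l : Fin k → ℕ}

/-- A rank function that increases from parents to children in the caterpillar. -/
def catRank {n k : ℕ} {l : Fin k → ℕ} : Fin (n + 1) ⊕ (Σ i : Fin k, Fin (l i + 1)) → ℕ
  | .inl j => j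
  | .inr ⟨_, b⟩ => n + 1 + b

theorem catParent_rank (u v : Fin (n + 1) ⊕ (Σ i : Fin k, Fin (l i + 1)))
    (h : catParent a l u = some v) : catRank v < catRank u := by
  rcases u with ⟨_ | j, hj⟩ | ⟨i, ⟨_ | b, hb⟩⟩
  · simp [catParent] at h
  all_goals
    simp only [catParent, Option.some.injEq] at h
    subst h
    simp [catRank]

theorem catParent_eq_none {u : Fin (n + 1) ⊕ (Σ i : Fin k, Fin (l i + 1))} :
    catParent a l u = none ↔ u = .inl 0 := by
  rcases u with ⟨_ | j, hj⟩ | ⟨i, ⟨_ | b, hb⟩⟩ <;> simp [catParent, Fin.ext_iff]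

theorem catParent_eq_inl {u : Fin (n + 1) ⊕ (Σ i : Fin k, Fin (l i + 1))} {j : Fin (n + 1)} :
    catParent a l u = some (.inl j) ↔
      (∃ h : (j : ℕ) + 1 < n + 1, u = .inl ⟨j + 1, h⟩) ∨
        ∃ i, u = .inr ⟨i, 0⟩ ∧ (a i).castSucc = j := by
  rcases u with ⟨_ | j', hj⟩ | ⟨i, ⟨_ | b, hb⟩⟩
  · simp [catParent]
  · simp only [catParent, Option.some.injEq, Sum.inl.injEq, reduceCtorEq, false_and, exists_false,
      or_false, Fin.ext_iff, Nat.add_right_cancel_iff]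
    constructor
    · rintro rfl
      exact ⟨hj, rfl⟩
    · rintro ⟨_, h⟩
      exact h
  · simp only [catParent, Option.some.injEq, Sum.inl.injEq, reduceCtorEq, exists_false, false_or,
      Sum.inr.injEq]
    constructor
    · intro h
      exact ⟨i, rfl, h⟩
    · rintro ⟨i', h, h'⟩
      rw [(Sigma.mk.inj_iff.1 h).1]
      exact h'
  · simp only [catParent, Option.some.injEq, reduceCtorEq, exists_false, false_or,
      Sum.inr.injEq, false_iff, not_exists, not_and]
    intro i' h
    obtain ⟨rfl, h⟩ := Sigma.mk.inj_iff.1 h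
    have := congrArg Fin.val (eq_of_heq h)
    simp at this

theorem catParent_eq_inr {u : Fin (n + 1) ⊕ (Σ i : Fin k, Fin (l i + 1))} {i : Fin k}
    {b : Fin (l i + 1)} :
    catParent a l u = some (.inr ⟨i, b⟩) ↔
      ∃ h : (b : ℕ) + 1 < l i + 1, u = .inr ⟨i, ⟨b + 1, h⟩⟩ := by
  rcases u with ⟨_ | j', hj⟩ | ⟨i', ⟨_ | b', hb⟩⟩
  · simp [catParent]
  · simp [catParent]
  · simp only [catParent, Option.some.injEq, reduceCtorEq, Sum.inr.injEq, false_iff, not_exists]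
    intro h h'
    obtain ⟨rfl, h'⟩ := Sigma.mk.inj_iff.1 h'
    have := Fin.mk.inj_iff.1 (eq_of_heq h')
    omega
  · simp only [catParent, Option.some.injEq, Sum.inr.injEq]
    constructor
    · intro h
      obtain ⟨rfl, h⟩ := Sigma.mk.inj_iff.1 h
      obtain rfl := eq_of_heq h
      exact ⟨hb, rfl⟩
    · rintro ⟨h, h'⟩
      obtain ⟨rfl, h'⟩ := Sigma.mk.inj_iff.1 h'
      have := Fin.mk.inj_iff.1 (eq_of_heq h')
      obtain rfl : b' = b := by omega
      rfl

theorem catParent_ne_some (v : Fin (n + 1) ⊕ (Σ i : Fin k, Fin (l i + 1))) :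
    (∀ u, catParent a l u ≠ some v) ↔
      v = .inl (Fin.last n) ∨ ∃ i, v = .inr ⟨i, Fin.last (l i)⟩ := by
  rcases v with j | ⟨i, b⟩
  · simp only [Sum.inl.injEq, reduceCtorEq, exists_false, or_false, ne_eq, catParent_eq_inl, not_or,
      not_exists, not_and]
    constructor
    · intro h
      by_contra hj
      have : (j : ℕ) ≠ n := fun e => hj (Fin.ext e)
      exact (h (.inl ⟨j + 1, by omega⟩)).1 (by omega) rfl
    · rintro rfl u
      refine ⟨fun h => absurd h (by simp), fun i _ h => ?_⟩
      have h1 : (a i : ℕ) = n := congrArg Fin.val h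
      have h2 := (a i).2
      omega
  · simp only [reduceCtorEq, false_or, ne_eq, catParent_eq_inr, not_exists, Sum.inr.injEq]
    constructor
    · intro h
      refine ⟨i, ?_⟩
      by_contra hb
      have : (b : ℕ) ≠ l i := fun e => hb (by
        obtain rfl : b = Fin.last (l i) := Fin.ext e
        rfl)
      exact h (.inr ⟨i, ⟨b + 1, by omega⟩⟩) (by omega) rfl
    · rintro ⟨j, h⟩ u h'
      obtain ⟨rfl, h⟩ := Sigma.mk.inj_iff.1 h
      obtain rfl := eq_of_heq h
      simp at h'

theorem neighborSet_treeOf_some {α : Type*} (p : α → Option α) (v : α) :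
    (treeOf p).neighborSet (some v) ⊆ insert (p v) (some '' {c | p c = some v}) := by
  rintro x ⟨-, ⟨c, hc, hc'⟩ | ⟨c, hc, hc'⟩⟩
  · left
    rw [← hc', Option.some.inj hc]
  · right
    exact ⟨c, hc', hc.symm⟩

theorem encard_le_three {α : Type*} {s : Set α} (x y z : α) (h : s ⊆ {x, y, z}) :
    s.encard ≤ 3 := by
  classical
  have h' : s ⊆ (({x, y, z} : Finset α) : Set α) := by simpa using h
  refine (Set.encard_le_encard h').trans ?_
  rw [Set.encard_coe_eq_coe_finsetCard]
  exact_mod_cast Finset.card_le_three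

theorem encard_lt_three {α : Type*} {s : Set α} (x y : α) (h : s ⊆ {x, y}) :
    s.encard < 3 := by
  classical
  have h' : s ⊆ (({x, y} : Finset α) : Set α) := by simpa using h
  refine (Set.encard_le_encard h').trans_lt ?_
  rw [Set.encard_coe_eq_coe_finsetCard]
  exact_mod_cast Nat.lt_succ_of_le Finset.card_le_two

theorem isCaterpillar_treeOf_catParent (hk : 0 < k) (ha : Function.Injective a) :
    IsCaterpillar (treeOf (catParent a l)) := by
  have hroot : ((treeOf (catParent a l)).neighborSet none).encard < 3 := by
    apply encard_lt_three (some (.inl 0)) none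
    rintro x ⟨-, ⟨c, hc, hc'⟩ | ⟨c, hc, hc'⟩⟩
    · simp at hc
    · rw [catParent_eq_none] at hc'
      left
      rw [hc, hc']
  have hleg : ∀ i b, ((treeOf (catParent a l)).neighborSet (some (.inr ⟨i, b⟩))).encard < 3 := by
    intro i b
    by_cases hb : (b : ℕ) + 1 < l i + 1
    · refine encard_lt_three _ (some (.inr ⟨i, ⟨b + 1, hb⟩⟩))
        ((neighborSet_treeOf_some _ _).trans (Set.insert_subset_insert ?_))
      rintro _ ⟨c, hc, rfl⟩
      obtain ⟨_, h⟩ := catParent_eq_inr.1 hc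
      exact congrArg some h
    · refine encard_lt_three _ none
        ((neighborSet_treeOf_some _ _).trans (Set.insert_subset_insert ?_))
      rintro _ ⟨c, hc, rfl⟩
      obtain ⟨h, _⟩ := catParent_eq_inr.1 hc
      exact absurd h hb
  have hspine : ∀ j, ((treeOf (catParent a l)).neighborSet (some (.inl j))).encard ≤ 3 := by
    intro j
    let y : Option (Fin (n + 1) ⊕ (Σ i : Fin k, Fin (l i + 1))) :=
      if h : (j : ℕ) + 1 < n + 1 then some (.inl ⟨j + 1, h⟩) else none
    by_cases hj : ∃ i, (a i).castSucc = j
    · obtain ⟨i, hi⟩ := hj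
      refine encard_le_three _ y (some (.inr ⟨i, 0⟩))
        ((neighborSet_treeOf_some _ _).trans (Set.insert_subset_insert ?_))
      rintro _ ⟨c, hc, rfl⟩
      rcases catParent_eq_inl.1 hc with ⟨h, rfl⟩ | ⟨i', rfl, hi'⟩
      · left
        simp only [y, dif_pos h]
      · right
        obtain rfl : i' = i := ha (Fin.castSucc_injective _ (hi'.trans hi.symm))
        rfl
    · refine encard_le_three _ y none
        ((neighborSet_treeOf_some _ _).trans (Set.insert_subset_insert ?_))
      rintro _ ⟨c, hc, rfl⟩
      rcases catParent_eq_inl.1 hc with ⟨h, rfl⟩ | ⟨i', rfl, hi'⟩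
      · left
        simp only [y, dif_pos h]
      · exact absurd ⟨i', hi'⟩ hj
  refine ⟨isTree_treeOf catParent_rank, ⟨?_, ?_⟩, ?_⟩
  · rintro (_ | j | ⟨i, b⟩)
    · exact hroot.le
    · exact hspine j
    · exact (hleg i b).le
  · let i : Fin k := ⟨0, hk⟩
    have hai : ((a i : ℕ)) + 1 < n + 1 := by
      have := (a i).2
      omega
    refine ⟨some (.inl (a i).castSucc), le_antisymm (hspine _) ?_⟩
    have hsub : ({catParent a l (.inl (a i).castSucc), some (.inl ⟨a i + 1, hai⟩),
        some (.inr ⟨i, 0⟩)} : Set _) ⊆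
        (treeOf (catParent a l)).neighborSet (some (.inl (a i).castSucc)) := by
      rintro x (rfl | rfl | rfl)
      · exact treeOf_adj_parent catParent_rank _
      · exact (treeOf_adj_parent (p := catParent a l) catParent_rank (.inl ⟨a i + 1, hai⟩)).symm
      · exact (treeOf_adj_parent (p := catParent a l) catParent_rank (.inr ⟨i, 0⟩)).symm
    refine le_trans (le_of_eq ?_) (Set.encard_le_encard hsub)
    symm
    rw [Set.encard_eq_three]
    refine ⟨_, _, _, ?_, ?_, ?_, rfl⟩
    · intro h
      have := catParent_rank (a := a) (l := l) _ _ h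
      simp [catRank] at this
    · intro h
      have := catParent_rank (a := a) (l := l) _ _ h
      simp [catRank] at this
      omega
    · simp
  · let s : ℕ → Option (Fin (n + 1) ⊕ (Σ i : Fin k, Fin (l i + 1))) := fun j =>
      if h : 0 < j ∧ j - 1 < n + 1 then some (.inl ⟨j - 1, h.2⟩) else none
    have h0 : s 0 = none := dif_neg (by omega)
    have h1 : ∀ j (hj : j < n + 1), s (j + 1) = some (.inl ⟨j, hj⟩) :=
      fun j hj => dif_pos ⟨by omega, hj⟩
    refine ⟨s '' Set.Iic (n + 1), isPath_induce_image ?_ ?_, ?_⟩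
    · rintro (_ | i) (_ | j) hi hj h
      · rfl
      · rw [h0, h1 j (by omega)] at h
        simp at h
      · rw [h0, h1 i (by omega)] at h
        simp at h
      · rw [h1 i (by omega), h1 j (by omega)] at h
        simpa using h
    · rintro i (_ | j) hij hj
      · omega
      have hp : ∀ j (hj : j < n + 1), catParent a l (.inl ⟨j, hj⟩) = s j := by
        rintro (_ | j) hj
        · exact h0.symm
        · rw [h1 j (by omega)]
          rfl
      have h2 := treeOf_adj_parent (p := catParent a l) catParent_rank (.inl ⟨j, by omega⟩)
      rw [hp] at h2
      rw [h1 j (by omega)]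
      constructor
      · rintro ⟨-, ⟨c, hc, hc'⟩ | ⟨c, hc, hc'⟩⟩
        · obtain rfl | ⟨i, rfl⟩ : i = 0 ∨ ∃ i', i = i' + 1 := by
            cases i
            · exact Or.inl rfl
            · exact Or.inr ⟨_, rfl⟩
          · rw [h0] at hc
            simp at hc
          · rw [h1 i (by omega)] at hc
            rw [← Option.some.inj hc] at hc'
            have := catParent_rank _ _ hc'
            simp [catRank] at this
            omega
        · rw [← Option.some.inj hc, hp] at hc'
          by_contra hne
          rcases i with _ | i
          · rcases j with _ | j
            · omega
            · rw [h0, h1 j (by omega)] at hc'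
              simp at hc'
          · rcases j with _ | j
            · omega
            · rw [h1 i (by omega), h1 j (by omega)] at hc'
              simp at hc'
              omega
      · intro h
        obtain rfl : i = j := by omega
        exact h2.symm
    · rintro (_ | j | ⟨i, b⟩) h
      · exact absurd h hroot.ne
      · exact ⟨j + 1, by simp only [Set.mem_Iic]; omega, h1 j j.2⟩
      · exact absurd h (hleg i b).ne

end Caterpillar

/-! ### Recognizing connectifiers by levels -/

/-- The graph `T` has an induced subgraph of one of the four types of the theorem with exactly `h`
simplicial vertices, all of which lie in `W`. The subgraph is encoded by an embedding of an
abstract graph `M`. -/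
def HasConnectifier {U : Type*} (T : SimpleGraph U) (W : Set U) (h : ℕ) : Prop :=
  ∃ (β : Type) (M : SimpleGraph β),
    (IsCaterpillar M ∨ IsLineGraphOfCaterpillar M ∨ IsSubdividedStar M ∨
      IsLineGraphOfSubdividedStar M) ∧
    (simplicialVertices M).ncard = h ∧ ∃ f : M ↪g T, ∀ v ∈ simplicialVertices M, f v ∈ W

theorem ncard_range_fin {α : Type*} {k : ℕ} {f : Fin k → α} (hf : Function.Injective f) :
    (Set.range f).ncard = k := by
  rw [← Set.image_univ, Set.ncard_image_of_injective _ hf, Set.ncard_univ, Nat.card_fin]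

section Star

variable {δ : ℕ} {l : Fin δ → ℕ}

theorem simplicialVertices_treeOf_starParent (hδ : 2 ≤ δ) :
    simplicialVertices (treeOf (starParent l)) = Set.range fun i => some ⟨i, Fin.last (l i)⟩ := by
  ext (_ | v)
  · simp only [Set.mem_range, reduceCtorEq, exists_false, iff_false]
    rw [none_mem_simplicialVertices_treeOf]
    intro h
    have := h ⟨⟨0, by omega⟩, 0⟩ ⟨⟨1, by omega⟩, 0⟩ rfl rfl
    simp at this
  · rw [some_mem_simplicialVertices_treeOf (starParent_rank l), starParent_ne_some]
    simp [eq_comm]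

theorem simplicialVertices_sibGraph_starParent (hδ : 2 ≤ δ) :
    simplicialVertices (sibGraph (starParent l)) = Set.range fun i => ⟨i, Fin.last (l i)⟩ := by
  ext v
  rw [mem_simplicialVertices_sibGraph (starParent_rank l), starParent_ne_some]
  constructor
  · rintro (⟨i, hi⟩ | ⟨-, h⟩)
    · exact ⟨i, hi.symm⟩
    · have := (h ⟨⟨0, by omega⟩, 0⟩ rfl).trans (h ⟨⟨1, by omega⟩, 0⟩ rfl).symm
      simp at this
  · rintro ⟨i, hi⟩
    exact Or.inl ⟨i, hi.symm⟩

variable {U : Type*} {T : SimpleGraph U} {W : Set U} {d : U → ℕ} {y : Fin δ → ℕ → U}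

theorem hasConnectifier_of_star (hδ : 3 ≤ δ) {c : U} (hc : d c = 0)
    (hd : ∀ u v, T.Adj u v → d v ≤ d u + 1)
    (hy : ∀ i, ∀ b ≤ l i, d (y i b) = b + 1)
    (hadj : ∀ i, ∀ b < l i, T.Adj (y i b) (y i (b + 1)))
    (hcadj : ∀ i, T.Adj (y i 0) c)
    (hyy : ∀ i i', i ≠ i' → ∀ b ≤ l i, ∀ b' ≤ l i', y i b ≠ y i' b' ∧ ¬ T.Adj (y i b) (y i' b'))
    (hW : ∀ i, y i (l i) ∈ W) :
    HasConnectifier T W δ := by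
  let g : Option (Σ i : Fin δ, Fin (l i + 1)) → U := fun u => u.elim c fun v => y v.1 v.2
  obtain ⟨f, hf⟩ := exists_embedding_treeOf (T := T) (p := starParent l) d g
    (by
      rintro (_ | ⟨i, b⟩) (_ | ⟨i', b'⟩) h
      · rfl
      · have := congrArg d h
        simp only [g, Option.elim, hc, hy i' b' (by omega)] at this
        omega
      · have := congrArg d h
        simp only [g, Option.elim, hc, hy i b (by omega)] at this
        omega
      · simp only [g, Option.elim] at h
        by_cases hi : i = i'
        · subst hi
          have := congrArg d h
          rw [hy i b (by omega), hy i b' (by omega)] at this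
          obtain rfl : b = b' := Fin.ext (by omega)
          rfl
        · exact absurd h (hyy i i' hi b (by omega) b' (by omega)).1)
    (by
      intro a
      simp [g, hc])
    (by
      rintro ⟨i, ⟨_ | b, hb⟩⟩
      · exact hcadj i
      · exact (hadj i b (by omega)).symm)
    (by
      rintro ⟨i, ⟨b, hb⟩⟩ (_ | ⟨i', ⟨b', hb'⟩⟩) h hle
      · have := hd _ _ h.symm
        simp only [g, Option.elim, hc, hy i b (by omega)] at this
        obtain rfl : b = 0 := by omega
        rfl
      · simp only [g, Option.elim] at h hle
        by_cases hi : i = i'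
        · subst hi
          have := hd _ _ h.symm
          rw [hy i b (by omega), hy i b' (by omega)] at *
          obtain rfl | rfl : b = b' ∨ b = b' + 1 := by omega
          · exact absurd rfl h.ne
          · rfl
        · exact absurd h (hyy i i' hi b (by omega) b' (by omega)).2)
  refine ⟨_, treeOf (starParent l), Or.inr (Or.inr (Or.inl ?_)), ?_, f, ?_⟩
  · exact ⟨δ, hδ, l, ⟨treeOf_starParent l ▸ Iso.refl⟩⟩
  · rw [simplicialVertices_treeOf_starParent (by omega), ncard_range_fin]
    intro i j h
    simp at h
    exact h.1
  · rw [simplicialVertices_treeOf_starParent (by omega)]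
    rintro _ ⟨i, rfl⟩
    rw [hf]
    exact hW i

theorem hasConnectifier_of_star_lineGraph (hδ : 3 ≤ δ)
    (hd : ∀ u v, T.Adj u v → d v ≤ d u + 1)
    (hy : ∀ i, ∀ b ≤ l i, d (y i b) = b + 1)
    (hadj : ∀ i, ∀ b < l i, T.Adj (y i b) (y i (b + 1)))
    (hclique : ∀ i i', i ≠ i' → T.Adj (y i 0) (y i' 0))
    (hyy : ∀ i i', i ≠ i' → ∀ b ≤ l i, ∀ b' ≤ l i',
      y i b ≠ y i' b' ∧ (T.Adj (y i b) (y i' b') → b = 0 ∧ b' = 0))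
    (hW : ∀ i, y i (l i) ∈ W) :
    HasConnectifier T W δ := by
  let g : (Σ i : Fin δ, Fin (l i + 1)) → U := fun v => y v.1 v.2
  obtain ⟨f, hf⟩ := exists_embedding_sibGraph (T := T) (p := starParent l) d g
    (by
      rintro ⟨i, b⟩ ⟨i', b'⟩ h
      simp only [g] at h
      by_cases hi : i = i'
      · subst hi
        have := congrArg d h
        rw [hy i b (by omega), hy i b' (by omega)] at this
        obtain rfl : b = b' := Fin.ext (by omega)
        rfl
      · exact absurd h (hyy i i' hi b (by omega) b' (by omega)).1)
    (by
      rintro ⟨i, ⟨_ | b, hb⟩⟩ v h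
      · simp [starParent_zero] at h
      · obtain rfl := Option.some.inj h
        exact (hadj i b (by omega)).symm)
    (by
      rintro ⟨i, ⟨_ | b, hb⟩⟩ ⟨i', ⟨_ | b', hb'⟩⟩ hne h
      · exact hclique i i' fun e => hne (by subst e; rfl)
      · simp [starParent] at h
      · simp [starParent] at h
      · obtain ⟨rfl, h⟩ := Sigma.mk.inj_iff.1 (Option.some.inj h)
        obtain rfl := Fin.mk.inj_iff.1 (eq_of_heq h)
        exact absurd rfl hne)
    (by
      rintro ⟨i, ⟨b, hb⟩⟩ ⟨i', ⟨b', hb'⟩⟩ h hle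
      simp only [g] at h hle
      by_cases hi : i = i'
      · subst hi
        have := hd _ _ h.symm
        rw [hy i b (by omega), hy i b' (by omega)] at *
        obtain rfl | rfl : b = b' ∨ b = b' + 1 := by omega
        · exact absurd rfl h.ne
        · exact Or.inl rfl
      · obtain ⟨rfl, rfl⟩ := (hyy i i' hi b (by omega) b' (by omega)).2 h
        exact Or.inr rfl)
  refine ⟨_, sibGraph (starParent l), Or.inr (Or.inr (Or.inr ?_)), ?_, f, ?_⟩
  · have := exists_iso_lineGraph_treeOf (starParent_rank l)
    rw [treeOf_starParent] at this
    exact ⟨δ, hδ, l, this⟩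
  · rw [simplicialVertices_sibGraph_starParent (by omega), ncard_range_fin]
    intro i j h
    exact (Sigma.mk.inj_iff.1 h).1
  · rw [simplicialVertices_sibGraph_starParent (by omega)]
    rintro _ ⟨i, rfl⟩
    rw [hf]
    exact hW i

end Star

section Caterpillar

variable {n k : ℕ} {a : Fin k → Fin n} {l : Fin k → ℕ}

theorem simplicialVertices_treeOf_catParent :
    simplicialVertices (treeOf (catParent a l)) =
      insert none (insert (some (.inl (Fin.last n)))
        (Set.range fun i => some (.inr ⟨i, Fin.last (l i)⟩))) := by
  ext (_ | v)
  · simp only [Set.mem_insert_iff, true_or, iff_true]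
    rw [none_mem_simplicialVertices_treeOf]
    intro u v hu hv
    rw [catParent_eq_none] at hu hv
    rw [hu, hv]
  · rw [some_mem_simplicialVertices_treeOf catParent_rank, catParent_ne_some]
    simp [eq_comm]

theorem simplicialVertices_sibGraph_catParent :
    simplicialVertices (sibGraph (catParent a l)) =
      insert (.inl 0) (insert (.inl (Fin.last n))
        (Set.range fun i => .inr ⟨i, Fin.last (l i)⟩)) := by
  ext v
  rw [mem_simplicialVertices_sibGraph catParent_rank, catParent_ne_some]
  simp only [catParent_eq_none, forall_eq, Set.mem_insert_iff, Set.mem_range, eq_comm (a := v)]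
  constructor
  · rintro (h | h)
    · exact Or.inr h
    · exact Or.inl h.1
  · rintro (h | h)
    · exact Or.inr ⟨h, h⟩
    · exact Or.inl h

variable {U : Type*} {T : SimpleGraph U} {W : Set U} {d : U → ℕ} {s : ℕ → U} {y : Fin k → ℕ → U}

/-- A path that meets its levels in order, together with pairwise anticomplete legs attached to one
inner vertex each, forms a caterpillar. -/
theorem hasConnectifier_of_caterpillar (hk : 0 < k) (ha : Function.Injective a)
    (hd : ∀ u v, T.Adj u v → d v ≤ d u + 1)
    (hs : ∀ j ≤ n + 1, d (s j) = j) (hsadj : ∀ j ≤ n, T.Adj (s j) (s (j + 1)))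
    (hy : ∀ i, ∀ b ≤ l i, d (y i b) = a i + 2 + b)
    (hadj : ∀ i, ∀ b < l i, T.Adj (y i b) (y i (b + 1)))
    (hatt : ∀ i, T.Adj (y i 0) (s (a i + 1)))
    (hys : ∀ i, ∀ b ≤ l i, ∀ j ≤ n + 1,
      y i b ≠ s j ∧ (T.Adj (y i b) (s j) → b = 0 ∧ j = a i + 1))
    (hyy : ∀ i i', i ≠ i' → ∀ b ≤ l i, ∀ b' ≤ l i', y i b ≠ y i' b' ∧ ¬ T.Adj (y i b) (y i' b'))
    (hW0 : s 0 ∈ W) (hWn : s (n + 1) ∈ W) (hW : ∀ i, y i (l i) ∈ W) :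
    HasConnectifier T W (k + 2) := by
  let g : Option (Fin (n + 1) ⊕ (Σ i : Fin k, Fin (l i + 1))) → U := fun u =>
    u.elim (s 0) (Sum.elim (fun j => s (j + 1)) fun v => y v.1 v.2)
  have hsinj : ∀ i j, i ≤ n + 1 → j ≤ n + 1 → s i = s j → i = j := by
    intro i j hi hj h
    rw [← hs i hi, h, hs j hj]
  obtain ⟨f, hf⟩ := exists_embedding_treeOf (T := T) (p := catParent a l) d g
    (by
      rintro (_ | j | ⟨i, b⟩) (_ | j' | ⟨i', b'⟩) h
      · rfl
      · have := hsinj _ _ (by omega) (by omega) h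
        omega
      · exact absurd h.symm (hys i' b' (by omega) 0 (by omega)).1
      · have := hsinj _ _ (by omega) (by omega) h
        omega
      · have := hsinj _ _ (by omega) (by omega) h
        obtain rfl : j = j' := Fin.ext (by omega)
        rfl
      · exact absurd h.symm (hys i' b' (by omega) (j + 1) (by omega)).1
      · exact absurd h (hys i b (by omega) 0 (by omega)).1
      · exact absurd h (hys i b (by omega) (j' + 1) (by omega)).1
      · by_cases hi : i = i'
        · subst hi
          have := congrArg d h
          simp only [g, Option.elim, Sum.elim_inr, hy i b (by omega), hy i b' (by omega)] at this
          obtain rfl : b = b' := Fin.ext (by omega)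
          rfl
        · exact absurd h (hyy i i' hi b (by omega) b' (by omega)).1)
    (by
      intro u
      simp [g, hs])
    (by
      rintro (⟨_ | j, hj⟩ | ⟨i, ⟨_ | b, hb⟩⟩)
      · exact (hsadj 0 (by omega)).symm
      · exact (hsadj (j + 1) (by omega)).symm
      · exact hatt i
      · exact (hadj i b (by omega)).symm)
    (by
      rintro (⟨j, hj⟩ | ⟨i, ⟨b, hb⟩⟩) (_ | ⟨j', hj'⟩ | ⟨i', ⟨b', hb'⟩⟩) h hle
      all_goals
        have hlev := hd _ _ h.symm
        simp only [g, Option.elim, Sum.elim_inr, Sum.elim_inl] at h hle hlev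
      · rw [hs _ (by omega), hs _ (by omega)] at hlev
        obtain rfl : j = 0 := by omega
        rfl
      · rw [hs _ (by omega), hs _ (by omega)] at hlev hle
        obtain rfl | rfl : j = j' ∨ j = j' + 1 := by omega
        · exact absurd rfl h.ne
        · rfl
      · have := (hys i' b' (by omega) _ (by omega)).2 h.symm
        rw [hs _ (by omega), hy _ _ (by omega)] at hle
        omega
      · have := (hys i b (by omega) _ (by omega)).2 h
        omega
      · obtain ⟨rfl, h'⟩ := (hys i b (by omega) _ (by omega)).2 h
        obtain rfl : j' = a i := by omega
        rfl
      · by_cases hi : i = i'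
        · subst hi
          rw [hy _ _ (by omega), hy _ _ (by omega)] at hlev hle
          obtain rfl | rfl : b = b' ∨ b = b' + 1 := by omega
          · exact absurd rfl h.ne
          · rfl
        · exact absurd h (hyy i i' hi b (by omega) b' (by omega)).2)
  refine ⟨_, treeOf (catParent a l), Or.inl (isCaterpillar_treeOf_catParent hk ha), ?_, f, ?_⟩
  · rw [simplicialVertices_treeOf_catParent, Set.ncard_insert_of_notMem (by simp),
      Set.ncard_insert_of_notMem (by simp), ncard_range_fin]
    intro i j h
    simp at h
    exact h.1
  · rw [simplicialVertices_treeOf_catParent]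
    rintro _ (rfl | rfl | ⟨i, rfl⟩)
    · rw [hf]
      exact hW0
    · rw [hf]
      exact hWn
    · rw [hf]
      exact hW i

/-- A path that meets its levels in order, together with pairwise anticomplete legs that form a
triangle with an edge of the path each, forms the line graph of a caterpillar. -/
theorem hasConnectifier_of_caterpillar_lineGraph (hk : 0 < k) (ha : Function.Injective a)
    (hd : ∀ u v, T.Adj u v → d v ≤ d u + 1)
    (hs : ∀ j ≤ n, d (s j) = j) (hsadj : ∀ j < n, T.Adj (s j) (s (j + 1)))
    (hy : ∀ i, ∀ b ≤ l i, d (y i b) = a i + 1 + b)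
    (hadj : ∀ i, ∀ b < l i, T.Adj (y i b) (y i (b + 1)))
    (hatt : ∀ i, T.Adj (y i 0) (s (a i)))
    (hatt' : ∀ i, T.Adj (y i 0) (s (a i + 1)))
    (hys : ∀ i, ∀ b ≤ l i, ∀ j ≤ n,
      y i b ≠ s j ∧ (T.Adj (y i b) (s j) → b = 0 ∧ (j = a i ∨ j = a i + 1)))
    (hyy : ∀ i i', i ≠ i' → ∀ b ≤ l i, ∀ b' ≤ l i', y i b ≠ y i' b' ∧ ¬ T.Adj (y i b) (y i' b'))
    (hW0 : s 0 ∈ W) (hWn : s n ∈ W) (hW : ∀ i, y i (l i) ∈ W) :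
    HasConnectifier T W (k + 2) := by
  let g : Fin (n + 1) ⊕ (Σ i : Fin k, Fin (l i + 1)) → U :=
    Sum.elim (fun j => s j) fun v => y v.1 v.2
  have hsinj : ∀ i j, i ≤ n → j ≤ n → s i = s j → i = j := by
    intro i j hi hj h
    rw [← hs i hi, h, hs j hj]
  obtain ⟨f, hf⟩ := exists_embedding_sibGraph (T := T) (p := catParent a l) d g
    (by
      rintro (j | ⟨i, b⟩) (j' | ⟨i', b'⟩) h
      · have := hsinj _ _ (by omega) (by omega) h
        obtain rfl : j = j' := Fin.ext (by omega)
        rfl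
      · exact absurd h.symm (hys i' b' (by omega) j (by omega)).1
      · exact absurd h (hys i b (by omega) j' (by omega)).1
      · by_cases hi : i = i'
        · subst hi
          have := congrArg d h
          simp only [g, Sum.elim_inr, hy i b (by omega), hy i b' (by omega)] at this
          obtain rfl : b = b' := Fin.ext (by omega)
          rfl
        · exact absurd h (hyy i i' hi b (by omega) b' (by omega)).1)
    (by
      rintro u (j | ⟨i, b⟩) h
      · rcases catParent_eq_inl.1 h with ⟨hj, rfl⟩ | ⟨i, rfl, rfl⟩
        · exact (hsadj j (by omega)).symm
        · exact hatt i
      · obtain ⟨hb, rfl⟩ := catParent_eq_inr.1 h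
        exact (hadj i b (by omega)).symm)
    (by
      intro u v hne h
      rcases hv : catParent a l v with _ | j | ⟨i, b⟩
      · rw [hv] at h
        rw [catParent_eq_none] at h hv
        exact absurd (h.trans hv.symm) hne
      · rw [hv] at h
        rw [catParent_eq_inl] at h hv
        rcases h with ⟨hj, rfl⟩ | ⟨i, rfl, rfl⟩
        · rcases hv with ⟨_, rfl⟩ | ⟨i', rfl, rfl⟩
          · exact absurd rfl hne
          · exact (hatt' i').symm
        · rcases hv with ⟨_, rfl⟩ | ⟨i', rfl, h⟩
          · exact hatt' i
          · exact absurd (by rw [ha (Fin.castSucc_injective _ h)]) hne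
      · rw [hv] at h
        rw [catParent_eq_inr] at h hv
        obtain ⟨_, h⟩ := h
        obtain ⟨_, hv⟩ := hv
        exact absurd (h.trans hv.symm) hne)
    (by
      have key : ∀ i j (hj : j < n + 1), j = a i + 1 →
          catParent a l (.inl ⟨j, hj⟩) = catParent a l (.inr ⟨i, 0⟩) := by
        rintro i j hj rfl
        rfl
      rintro (⟨j, hj⟩ | ⟨i, ⟨b, hb⟩⟩) (⟨j', hj'⟩ | ⟨i', ⟨b', hb'⟩⟩) h hle
      all_goals
        have hlev := hd _ _ h.symm
        simp only [g, Sum.elim_inr, Sum.elim_inl] at h hle hlev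
      · rw [hs _ (by omega), hs _ (by omega)] at hlev hle
        obtain rfl | rfl : j = j' ∨ j = j' + 1 := by omega
        · exact absurd rfl h.ne
        · exact Or.inl rfl
      · obtain ⟨rfl, h'⟩ := (hys i' b' (by omega) _ (by omega)).2 h.symm
        rw [hs _ (by omega), hy _ _ (by omega)] at hle
        exact Or.inr (key i' j hj (by omega))
      · obtain ⟨rfl, rfl | h'⟩ := (hys i b (by omega) _ (by omega)).2 h
        · exact Or.inl rfl
        · exact Or.inr (key i j' hj' h').symm
      · by_cases hi : i = i'
        · subst hi
          rw [hy _ _ (by omega), hy _ _ (by omega)] at hlev hle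
          obtain rfl | rfl : b = b' ∨ b = b' + 1 := by omega
          · exact absurd rfl h.ne
          · exact Or.inl rfl
        · exact absurd h (hyy i i' hi b (by omega) b' (by omega)).2)
  have hn : 0 < n := (Nat.zero_le _).trans_lt (a ⟨0, hk⟩).2
  refine ⟨_, sibGraph (catParent a l), Or.inr (Or.inl
    (isLineGraphOfCaterpillar_sibGraph catParent_rank (isCaterpillar_treeOf_catParent hk ha))),
    ?_, f, ?_⟩
  · rw [simplicialVertices_sibGraph_catParent, Set.ncard_insert_of_notMem,
      Set.ncard_insert_of_notMem (by simp), ncard_range_fin]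
    · intro i j h
      simp at h
      exact h.1
    · simp [Fin.ext_iff]
      omega
  · rw [simplicialVertices_sibGraph_catParent]
    rintro _ (rfl | rfl | ⟨i, rfl⟩)
    · rw [hf]
      exact hW0
    · rw [hf]
      exact hWn
    · rw [hf]
      exact hW i

end Caterpillar

/-! ### Dominators and legs -/

section Dominators

variable {U : Type*} {T : SimpleGraph U} {W : Set U} {r q q' w x : U}

/-- Every walk from `r` to `x` passes through `q`. In particular `q` dominates itself. -/
def Dominates (T : SimpleGraph U) (r q x : U) : Prop :=
  ∀ p : T.Walk r x, q ∈ p.support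

/-- The set `W` contains every vertex whose removal does not disconnect `T`. -/
def ContainsNoncut (T : SimpleGraph U) (W : Set U) : Prop :=
  ∀ r w, r ≠ w → (∀ x, Dominates T r w x → x = w) → w ∈ W

theorem dist_le_dist_add_one (hT : T.Connected) (r : U) (u v : U) (h : T.Adj u v) :
    T.dist r v ≤ T.dist r u + 1 := by
  have h1 := hT.dist_triangle (u := r) (v := u) (w := v)
  rw [dist_eq_one_iff_adj.2 h] at h1
  exact h1

theorem exists_adj_dist_eq (hT : T.Connected) (h : x ≠ r) :
    ∃ z, T.Adj z x ∧ T.dist r x = T.dist r z + 1 := by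
  obtain ⟨p, hp⟩ := hT.exists_walk_length_eq_dist x r
  cases p with
  | nil => exact absurd rfl h
  | @cons _ z _ hz p =>
    refine ⟨z, hz.symm, le_antisymm (dist_le_dist_add_one hT r z x hz.symm) ?_⟩
    rw [Walk.length_cons] at hp
    rw [dist_comm (u := r) (v := x), ← hp, dist_comm (u := r)]
    exact Nat.succ_le_succ (dist_le p)

theorem dominates_self (r q : U) : Dominates T r q q :=
  fun p => p.end_mem_support

theorem Dominates.adj (h : Dominates T r q x) (hne : x ≠ q) {z : U} (hz : T.Adj x z) :
    Dominates T r q z := by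
  intro p
  have := h (p.concat hz.symm)
  rw [Walk.support_concat, List.mem_append, List.mem_singleton] at this
  exact this.resolve_right hne.symm

theorem Dominates.trans (h : Dominates T r q w) (h' : Dominates T r w x) : Dominates T r q x := by
  classical
  intro p
  exact p.support_takeUntil_subset_support (h' p) (h (p.takeUntil w (h' p)))

theorem not_dominates_root (h : q ≠ r) : ¬ Dominates T r q r := by
  intro hq
  have := hq Walk.nil
  simp at this
  exact h this

/-- A walk that enters the set of vertices dominated by `q` meets `q`. -/
theorem Dominates.mem_support {u : U} (h : Dominates T r q x) (hu : ¬ Dominates T r q u)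
    (p : T.Walk u x) : q ∈ p.support := by
  by_contra hq
  have key : ∀ {u v : U} (p : T.Walk u v), q ∉ p.support → Dominates T r q v →
      Dominates T r q u := by
    intro u v p
    induction p with
    | nil => exact fun _ h => h
    | cons hadj p ih =>
      intro hq h
      rw [Walk.support_cons, List.mem_cons, not_or] at hq
      exact (ih hq.2 h).adj (fun e => hq.2 (e ▸ p.start_mem_support)) hadj.symm
  exact hu (key p hq h)

/-- Dominators of a common vertex are comparable: otherwise a walk from `q` to `x` would have to meet
`q'`, its remainder would have to meet `q` again, and so on. -/
theorem dominates_or_dominates (hT : T.Connected) (h : Dominates T r q x)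
    (h' : Dominates T r q' x) : Dominates T r q q' ∨ Dominates T r q' q := by
  classical
  by_contra hcon
  rw [not_or] at hcon
  have key : ∀ n, ∀ a b, Dominates T r a x → Dominates T r b x → ¬ Dominates T r a b →
      ¬ Dominates T r b a → ∀ p : T.Walk a x, p.length ≤ n → False := by
    intro n
    induction n with
    | zero =>
      intro a b ha hb hab hba p hp
      have := p.eq_of_length_eq_zero (by omega)
      exact hba (this ▸ hb)
    | succ n ih =>
      intro a b ha hb hab hba p hp
      have hm := hb.mem_support hba p
      refine ih b a hb ha hba hab (p.dropUntil b hm) ?_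
      have h1 := congrArg Walk.length (p.take_spec hm)
      rw [Walk.length_append] at h1
      have h2 : (p.takeUntil b hm).length ≠ 0 := fun e =>
        hab ((p.takeUntil b hm).eq_of_length_eq_zero e ▸ dominates_self r a)
      omega
  obtain ⟨p⟩ := hT.preconnected q x
  exact key _ q q' h h' hcon.1 hcon.2 p le_rfl

/-- A geodesic from `q` to a vertex that it dominates continues a geodesic from `r` to `q`, and it
stays among the dominated vertices. -/
theorem Dominates.exists_geodesic (hT : T.Connected) (h : Dominates T r q w) :
    ∃ (m : ℕ) (x : ℕ → U), x 0 = q ∧ x m = w ∧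
      (∀ k ≤ m, Dominates T r q (x k) ∧ T.dist r (x k) = T.dist r q + k) ∧
      ∀ k < m, T.Adj (x k) (x (k + 1)) := by
  induction hn : T.dist r w generalizing w with
  | zero =>
    obtain rfl := (hT.dist_eq_zero_iff).1 hn
    have : q = r := by
      by_contra hne
      exact not_dominates_root hne h
    subst this
    refine ⟨0, fun _ => q, rfl, rfl, fun k hk => ⟨h, by simp; omega⟩, fun k hk => by omega⟩
  | succ n ih =>
    by_cases hqw : w = q
    · subst hqw
      refine ⟨0, fun _ => w, rfl, rfl, fun k hk => ⟨h, by simp; omega⟩, fun k hk => by omega⟩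
    · have hwr : w ≠ r := by
        rintro rfl
        simp at hn
      obtain ⟨z, hz, hzd⟩ := exists_adj_dist_eq hT hwr
      obtain ⟨m, x, h0, hm, hx, hadj⟩ := ih (h.adj hqw hz.symm) (by omega)
      have hne : ∀ k ≤ m, k ≠ m + 1 := fun k hk => by omega
      refine ⟨m + 1, Function.update x (m + 1) w, ?_, by simp, ?_, ?_⟩
      · rw [Function.update_of_ne (by omega), h0]
      · intro k hk
        rcases Nat.lt_or_ge m k with hlt | hle
        · obtain rfl : k = m + 1 := by omega
          have := (hx m le_rfl).2
          rw [hm] at this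
          rw [Function.update_self]
          exact ⟨h, by omega⟩
        · rw [Function.update_of_ne (hne k hle)]
          exact hx k hle
      · intro k hk
        rw [Function.update_of_ne (hne k (by omega))]
        rcases Nat.lt_or_ge k m with hlt | hle
        · rw [Function.update_of_ne (hne _ (by omega))]
          exact hadj k hlt
        · obtain rfl : k = m := by omega
          rw [Function.update_self, hm]
          exact hz

theorem Dominates.dist_lt (hT : T.Connected) (h : Dominates T r q w) (hne : w ≠ q) :
    T.dist r q < T.dist r w := by
  obtain ⟨m, x, h0, hm, hx, -⟩ := h.exists_geodesic hT
  have := (hx m le_rfl).2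
  rw [hm] at this
  have hm0 : m ≠ 0 := by
    rintro rfl
    exact hne (hm.symm.trans h0)
  omega

/-- A vertex without neighbours on the next level is not a cut vertex. -/
theorem ContainsNoncut.mem_of_leaf (hW : ContainsNoncut T W) (hT : T.Connected) (hr : r ≠ w)
    (h : ∀ u, T.Adj w u → T.dist r u ≠ T.dist r w + 1) : w ∈ W := by
  refine hW r w hr fun x hx => ?_
  by_contra hne
  obtain ⟨m, y, h0, hm, hy, hadj⟩ := hx.exists_geodesic hT
  have hm0 : m ≠ 0 := by
    rintro rfl
    exact hne (hm.symm.trans h0)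
  have h1 := hadj 0 (by omega)
  rw [h0] at h1
  exact h _ h1 (hy 1 (by omega)).2

/-- Every vertex `q` other than the root starts a leg: a geodesic among the vertices that `q`
dominates, ending in `W`. A farthest vertex among those dominated by `q` is not a cut vertex. -/
theorem ContainsNoncut.exists_leg [Finite U] (hW : ContainsNoncut T W) (hT : T.Connected)
    (hq : q ≠ r) :
    ∃ (m : ℕ) (x : ℕ → U), x 0 = q ∧ x m ∈ W ∧
      (∀ k ≤ m, Dominates T r q (x k) ∧ T.dist r (x k) = T.dist r q + k) ∧
      ∀ k < m, T.Adj (x k) (x (k + 1)) := by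
  obtain ⟨w, hw, hmax⟩ := Set.exists_max_image {x | Dominates T r q x} (T.dist r)
    (Set.toFinite _) ⟨q, dominates_self r q⟩
  obtain ⟨m, x, h0, rfl, hx, hadj⟩ := Dominates.exists_geodesic hT hw
  refine ⟨m, x, h0, hW r _ ?_ ?_, hx, hadj⟩
  · intro h
    rw [← h] at hw
    exact not_dominates_root hq hw
  · intro y hy
    by_contra hne
    have h1 := hy.dist_lt hT hne
    have h2 := hmax y (Dominates.trans hw hy)
    omega

end Dominators

/-! ### Vertices of large degree -/

/-- A weak form of Ramsey's theorem. -/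
theorem exists_clique_or_independent {U : Type*} (T : SimpleGraph U) (s t : ℕ) (X : Finset U)
    (hX : 2 ^ (s + t) ≤ X.card) :
    (∃ Z ⊆ X, Z.card = s ∧ ∀ u ∈ Z, ∀ v ∈ Z, u ≠ v → T.Adj u v) ∨
      ∃ Z ⊆ X, Z.card = t ∧ ∀ u ∈ Z, ∀ v ∈ Z, u ≠ v → ¬ T.Adj u v := by
  classical
  induction hn : s + t generalizing s t X with
  | zero =>
    obtain rfl : s = 0 := by omega
    exact Or.inl ⟨∅, by simp, by simp⟩
  | succ n ih =>
    rcases s with _ | s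
    · exact Or.inl ⟨∅, by simp, by simp⟩
    rcases t with _ | t
    · exact Or.inr ⟨∅, by simp, by simp⟩
    have hX' : 2 ^ n + 2 ^ n ≤ X.card := by
      rw [hn, pow_succ] at hX
      omega
    have hpos : 0 < 2 ^ n := by positivity
    obtain ⟨v, hv⟩ : X.Nonempty := Finset.card_pos.1 (by omega)
    have hsplit := Finset.card_filter_add_card_filter_not (s := X.erase v) (T.Adj v)
    rw [Finset.card_erase_of_mem hv] at hsplit
    have hsub : ∀ P : U → Prop, [DecidablePred P] → (X.erase v).filter P ⊆ X := fun P _ =>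
      (Finset.filter_subset _ _).trans (Finset.erase_subset _ _)
    rcases Nat.lt_or_ge ((X.erase v).filter (T.Adj v)).card (2 ^ n) with hlt | hge
    · rcases ih (s + 1) t ((X.erase v).filter fun u => ¬ T.Adj v u) (by
          rw [show s + 1 + t = n by omega]
          omega) (by omega) with ⟨Z, hZ, h⟩ | ⟨Z, hZ, hc, h⟩
      · exact Or.inl ⟨Z, hZ.trans (hsub _), h⟩
      · have hvZ : v ∉ Z := fun h => by simpa using hZ h
        refine Or.inr ⟨insert v Z, Finset.insert_subset hv (hZ.trans (hsub _)), ?_, ?_⟩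
        · rw [Finset.card_insert_of_notMem hvZ, hc]
        · have hnot : ∀ u ∈ Z, ¬ T.Adj v u := fun u hu => (Finset.mem_filter.1 (hZ hu)).2
          intro a ha b hb hab
          rw [Finset.mem_insert] at ha hb
          rcases ha with rfl | ha <;> rcases hb with rfl | hb
          · exact absurd rfl hab
          · exact hnot b hb
          · exact fun e => hnot a ha e.symm
          · exact h a ha b hb hab
    · rcases ih s (t + 1) ((X.erase v).filter (T.Adj v)) (by
          rw [show s + (t + 1) = n by omega]
          omega) (by omega) with ⟨Z, hZ, hc, h⟩ | ⟨Z, hZ, h⟩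
      · have hvZ : v ∉ Z := fun h => by simpa using hZ h
        refine Or.inl ⟨insert v Z, Finset.insert_subset hv (hZ.trans (hsub _)), ?_, ?_⟩
        · rw [Finset.card_insert_of_notMem hvZ, hc]
        · have hadj : ∀ u ∈ Z, T.Adj v u := fun u hu => (Finset.mem_filter.1 (hZ hu)).2
          intro a ha b hb hab
          rw [Finset.mem_insert] at ha hb
          rcases ha with rfl | ha <;> rcases hb with rfl | hb
          · exact absurd rfl hab
          · exact hadj b hb
          · exact (hadj a ha).symm
          · exact h a ha b hb hab
      · exact Or.inr ⟨Z, hZ.trans (hsub _), h⟩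

/-- The legs starting at the neighbours of `v`, with `v` as the root, are anticomplete to each other
except for their first vertices, which Ramsey's theorem makes adjacent or non-adjacent. -/
theorem hasConnectifier_of_degree {U : Type*} [Finite U] {T : SimpleGraph U} {W : Set U}
    (hT : T.Connected) (hW : ContainsNoncut T W) {h : ℕ} (hh : 3 ≤ h) (v : U)
    (hv : 2 ^ (h + h) ≤ (T.neighborSet v).ncard) : HasConnectifier T W h := by
  classical
  let X : Finset U := (Set.toFinite (T.neighborSet v)).toFinset
  have hXmem : ∀ u, u ∈ X ↔ T.Adj v u := fun u => by simp [X]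
  have hX : 2 ^ (h + h) ≤ X.card := by
    rwa [← Set.ncard_eq_toFinset_card]
  have main : ∀ Z ⊆ X, Z.card = h → ∃ (l : Fin h → ℕ) (y : Fin h → ℕ → U),
      (∀ i, y i 0 ∈ Z) ∧ (∀ i i', i ≠ i' → y i 0 ≠ y i' 0) ∧
      (∀ i, ∀ b ≤ l i, T.dist v (y i b) = b + 1) ∧
      (∀ i, ∀ b < l i, T.Adj (y i b) (y i (b + 1))) ∧
      (∀ i, T.Adj (y i 0) v) ∧
      (∀ i i', i ≠ i' → ∀ b ≤ l i, ∀ b' ≤ l i',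
        y i b ≠ y i' b' ∧ (T.Adj (y i b) (y i' b') → b = 0 ∧ b' = 0)) ∧
      ∀ i, y i (l i) ∈ W := by
    intro Z hZ hc
    let e := Z.equivFinOfCardEq hc
    have hcv : ∀ i, T.Adj v (e.symm i) := fun i => (hXmem _).1 (hZ (e.symm i).2)
    have hleg := fun i => hW.exists_leg hT (hcv i).ne.symm
    choose l y h0 hmem hy hadj using hleg
    have hne : ∀ i i', i ≠ i' → y i 0 ≠ y i' 0 := by
      intro i i' hi heq
      rw [h0, h0] at heq
      exact hi (e.symm.injective (Subtype.ext heq))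
    have hdom : ∀ i i', i ≠ i' → ¬ Dominates T v (e.symm i) (e.symm i') := by
      intro i i' hi hd
      have := hd (hcv i').toWalk
      simp at this
      rcases this with h | h
      · exact (hcv i).ne h.symm
      · exact hi h
    have hdist : ∀ i, ∀ b ≤ l i, T.dist v (y i b) = b + 1 := by
      intro i b hb
      rw [(hy i b hb).2, dist_eq_one_iff_adj.2 (hcv i), add_comm]
    have hsep : ∀ i i', i ≠ i' → ∀ b ≤ l i, ¬ Dominates T v (e.symm i') (y i b) := by
      intro i i' hi b hb hd
      rcases dominates_or_dominates hT (hy i b hb).1 hd with h | h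
      · exact hdom i i' hi h
      · exact hdom i' i hi.symm h
    have key : ∀ i i', i ≠ i' → ∀ b ≤ l i, ∀ b' ≤ l i', T.Adj (y i b) (y i' b') → b = 0 := by
      intro i i' hi b hb b' hb' hadj'
      by_contra hb0
      have : y i b ≠ e.symm i := by
        intro heq
        have := congrArg (T.dist v) heq
        rw [hdist i b hb, dist_eq_one_iff_adj.2 (hcv i)] at this
        omega
      exact hsep i' i hi.symm b' hb' ((hy i b hb).1.adj this hadj')
    refine ⟨l, y, fun i => ?_, hne, hdist, hadj, fun i => ?_, ?_, hmem⟩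
    · rw [h0]
      exact (e.symm i).2
    · rw [h0]
      exact (hcv i).symm
    · intro i i' hi b hb b' hb'
      refine ⟨fun heq => hsep i i' hi b hb (heq ▸ (hy i' b' hb').1), fun hadj' => ?_⟩
      exact ⟨key i i' hi b hb b' hb' hadj', key i' i hi.symm b' hb' b hb hadj'.symm⟩
  rcases exists_clique_or_independent T h h X hX with ⟨Z, hZ, hc, hZadj⟩ | ⟨Z, hZ, hc, hZadj⟩
  · obtain ⟨l, y, hyZ, hne, hdist, hadj, hv, hyy, hmem⟩ := main Z hZ hc
    exact hasConnectifier_of_star_lineGraph hh (dist_le_dist_add_one hT v) hdist hadj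
      (fun i i' hi => hZadj _ (hyZ i) _ (hyZ i') (hne i i' hi)) hyy hmem
  · obtain ⟨l, y, hyZ, hne, hdist, hadj, hv, hyy, hmem⟩ := main Z hZ hc
    refine hasConnectifier_of_star hh (c := v) dist_self (dist_le_dist_add_one hT v) hdist hadj hv
      (fun i i' hi b hb b' hb' => ⟨(hyy i i' hi b hb b' hb').1, fun hadj' => ?_⟩) hmem
    obtain ⟨rfl, rfl⟩ := (hyy i i' hi b hb b' hb').2 hadj'
    exact hZadj _ (hyZ i) _ (hyZ i') (hne i i' hi) hadj'

/-! ### Geodesics with many branches -/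

/-- The number of marked vertices above a vertex that guarantees `e` events on some geodesic, in a
graph of maximum degree at most `Δ`. -/
def eventBound (Δ : ℕ) : ℕ → ℕ
  | 0 => 0
  | e + 1 => Δ * eventBound Δ e + 2

section Geodesic

variable {U : Type*} {T : SimpleGraph U} {W : Set U} {r : U}

/-- The vertex `u` is a neighbour of `v` on the next level. -/
def StepUp (T : SimpleGraph U) (r v u : U) : Prop :=
  T.Adj v u ∧ T.dist r u = T.dist r v + 1

/-- A geodesic away from `r` through many events, an event being a vertex of `A` or a vertex with a
second neighbour on the next level. Always moving on to the neighbour with the most vertices of `A`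
above it divides their number by at most the maximum degree, and only at events. -/
theorem exists_geodesic_events [Finite U] (A : Set U) {Δ : ℕ}
    (hΔ : ∀ v, (T.neighborSet v).ncard ≤ Δ) (e : ℕ) (v : U)
    (hv : eventBound Δ e ≤ (A ∩ {x | Relation.ReflTransGen (StepUp T r) v x}).ncard) :
    ∃ (N : ℕ) (s : ℕ → U) (E : Finset ℕ), s 0 = v ∧ (∀ j < N, StepUp T r (s j) (s (j + 1))) ∧
      (∀ u, ¬ StepUp T r (s N) u) ∧ e ≤ E.card ∧
      ∀ j ∈ E, j ≤ N ∧ (s j ∈ A ∨ (j < N ∧ ∃ q, StepUp T r (s j) q ∧ q ≠ s (j + 1))) := by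
  classical
  obtain ⟨w, -, hw⟩ := Set.exists_max_image Set.univ (T.dist r) (Set.toFinite _) ⟨v, trivial⟩
  obtain ⟨t, ht⟩ : ∃ t, T.dist r w ≤ T.dist r v + t := ⟨T.dist r w, by omega⟩
  let c : U → ℕ := fun v => (A ∩ {x | Relation.ReflTransGen (StepUp T r) v x}).ncard
  have hsub : ∀ v, A ∩ {x | Relation.ReflTransGen (StepUp T r) v x} ⊆
      (A ∩ {v}) ∪ ⋃ u ∈ (Set.toFinite {u | StepUp T r v u}).toFinset,
        A ∩ {x | Relation.ReflTransGen (StepUp T r) u x} := by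
    rintro v x ⟨hxA, hx⟩
    rcases Relation.ReflTransGen.cases_head hx with rfl | ⟨u, hu, hux⟩
    · exact Or.inl ⟨hxA, rfl⟩
    · right
      simp only [Set.Finite.mem_toFinset, Set.mem_ofPred_eq, Set.mem_iUnion]
      exact ⟨u, hu, hxA, hux⟩
  have hcount : ∀ v, c v ≤ (A ∩ {v}).ncard +
      ∑ u ∈ (Set.toFinite {u | StepUp T r v u}).toFinset, c u := by
    intro v
    refine (Set.ncard_le_ncard (hsub v) (Set.toFinite _)).trans ?_
    refine (Set.ncard_union_le _ _).trans (Nat.add_le_add_left ?_ _)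
    exact Finset.set_ncard_biUnion_le _ _
  have hone : ∀ v, (A ∩ {v}).ncard ≤ 1 := fun v =>
    (Set.ncard_le_ncard Set.inter_subset_right (Set.toFinite _)).trans (Set.ncard_singleton v).le
  have hzero : ∀ v, v ∉ A → (A ∩ {v}).ncard = 0 := fun v hv => by
    rw [Set.inter_singleton_eq_empty.2 hv, Set.ncard_empty]
  change eventBound Δ e ≤ c v at hv
  induction t generalizing e v with
  | zero =>
    have hleaf : ∀ u, ¬ StepUp T r v u := by
      intro u hu
      have h1 := hw u trivial
      have h2 := hu.2
      omega
    have h1 := hcount v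
    have h2 : (Set.toFinite {u | StepUp T r v u}).toFinset = ∅ := by
      ext u
      simp [hleaf]
    rw [h2, Finset.sum_empty] at h1
    have h3 := hone v
    have he : e = 0 := by
      rcases e with _ | e
      · rfl
      · simp only [eventBound] at hv
        omega
    exact ⟨0, fun _ => v, ∅, rfl, fun j hj => by omega, hleaf, by simp [he], by simp⟩
  | succ t ih =>
    by_cases hleaf : ∀ u, ¬ StepUp T r v u
    · have h1 := hcount v
      have h2 : (Set.toFinite {u | StepUp T r v u}).toFinset = ∅ := by
        ext u
        simp [hleaf]
      rw [h2, Finset.sum_empty] at h1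
      have h3 := hone v
      have he : e = 0 := by
        rcases e with _ | e
        · rfl
        · simp only [eventBound] at hv
          omega
      exact ⟨0, fun _ => v, ∅, rfl, fun j hj => by omega, hleaf, by simp [he], by simp⟩
    push Not at hleaf
    have hcons : ∀ u e', StepUp T r v u → eventBound Δ e' ≤ c u →
        (e = e' ∨ (e = e' + 1 ∧ (v ∈ A ∨ ∃ q, StepUp T r v q ∧ q ≠ u))) →
        ∃ (N : ℕ) (s : ℕ → U) (E : Finset ℕ), s 0 = v ∧
          (∀ j < N, StepUp T r (s j) (s (j + 1))) ∧ (∀ u, ¬ StepUp T r (s N) u) ∧ e ≤ E.card ∧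
          ∀ j ∈ E, j ≤ N ∧ (s j ∈ A ∨ (j < N ∧ ∃ q, StepUp T r (s j) q ∧ q ≠ s (j + 1))) := by
      intro u e' hu he' hcase
      obtain ⟨N, s, E, h0, hs, hN, hE, hev⟩ := ih e' u (by have := hu.2; omega) he'
      let s' : ℕ → U := fun j => Nat.casesOn j v s
      have hs' : ∀ j < N + 1, StepUp T r (s' j) (s' (j + 1)) := by
        rintro (_ | j) hj
        · change StepUp T r v (s 0)
          rwa [h0]
        · exact hs j (by omega)
      have hE' : ∀ j ∈ E.map ⟨Nat.succ, Nat.succ_injective⟩, j ≤ N + 1 ∧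
          (s' j ∈ A ∨ (j < N + 1 ∧ ∃ q, StepUp T r (s' j) q ∧ q ≠ s' (j + 1))) := by
        intro j hj
        obtain ⟨i, hi, rfl⟩ := Finset.mem_map.1 hj
        obtain ⟨h1, h2⟩ := hev i hi
        refine ⟨Nat.succ_le_succ h1, h2.imp id fun h => ⟨Nat.succ_lt_succ h.1, h.2⟩⟩
      rcases hcase with rfl | ⟨rfl, hv'⟩
      · exact ⟨N + 1, s', _, rfl, hs', hN, by rwa [Finset.card_map], hE'⟩
      · refine ⟨N + 1, s', insert 0 (E.map ⟨Nat.succ, Nat.succ_injective⟩), rfl, hs', hN, ?_, ?_⟩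
        · rw [Finset.card_insert_of_notMem (by simp), Finset.card_map]
          omega
        · intro j hj
          rcases Finset.mem_insert.1 hj with rfl | hj
          · refine ⟨by omega, hv'.imp id fun ⟨q, hq, hqu⟩ => ⟨by omega, q, hq, ?_⟩⟩
            change q ≠ s 0
            rwa [h0]
          · exact hE' j hj
    by_cases hev : v ∈ A ∨ ∃ u q, StepUp T r v u ∧ StepUp T r v q ∧ q ≠ u
    · obtain ⟨u₀, hu₀⟩ := hleaf
      have hev' : ∀ u, StepUp T r v u → v ∈ A ∨ ∃ q, StepUp T r v q ∧ q ≠ u := by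
        intro u hu
        rcases hev with h | ⟨u', q, hu', hq, hne⟩
        · exact Or.inl h
        · by_cases h : q = u
          · exact Or.inr ⟨u', hu', fun e => hne (h.trans e.symm)⟩
          · exact Or.inr ⟨q, hq, h⟩
      rcases e with _ | e
      · exact hcons u₀ 0 hu₀ (Nat.zero_le _) (Or.inl rfl)
      · obtain ⟨u, hu, hcu⟩ : ∃ u, StepUp T r v u ∧ eventBound Δ e ≤ c u := by
          by_contra hcon
          push Not at hcon
          have h1 := hcount v
          have h2 : ∑ u ∈ (Set.toFinite {u | StepUp T r v u}).toFinset, c u ≤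
              (Set.toFinite {u | StepUp T r v u}).toFinset.card • eventBound Δ e :=
            Finset.sum_le_card_nsmul _ _ _ fun u hu =>
              (hcon u (by simpa using hu)).le
          have h3 : (Set.toFinite {u | StepUp T r v u}).toFinset.card ≤ Δ := by
            rw [← Set.ncard_eq_toFinset_card]
            exact (Set.ncard_le_ncard (fun u hu => hu.1) (Set.toFinite _)).trans (hΔ v)
          have h4 := Nat.mul_le_mul_right (eventBound Δ e) h3
          have h5 := hone v
          simp only [eventBound, smul_eq_mul] at hv h2
          omega
        exact hcons u e hu hcu (Or.inr ⟨rfl, hev' u hu⟩)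
    · push Not at hev
      obtain ⟨u, hu⟩ := hleaf
      refine hcons u e hu ?_ (Or.inl rfl)
      have h1 := hcount v
      rw [hzero v hev.1, zero_add] at h1
      have h2 : (Set.toFinite {u | StepUp T r v u}).toFinset = {u} := by
        ext q
        simp only [Set.Finite.mem_toFinset, Set.mem_ofPred_eq, Finset.mem_singleton]
        constructor
        · exact fun hq => hev.2 u q hu hq
        · rintro rfl
          exact hu
      rw [h2, Finset.sum_singleton] at h1
      omega

theorem reflTransGen_stepUp (hT : T.Connected) (x : U) :
    Relation.ReflTransGen (StepUp T r) r x := by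
  induction hn : T.dist r x generalizing x with
  | zero =>
    obtain rfl := (hT.dist_eq_zero_iff).1 hn
    exact Relation.ReflTransGen.refl
  | succ n ih =>
    have hx : x ≠ r := by
      rintro rfl
      simp at hn
    obtain ⟨z, hz, hd⟩ := exists_adj_dist_eq hT hx
    exact (ih z (by omega)).tail ⟨hz, hd⟩

theorem isPath_of_geodesic (hT : T.Connected) {N : ℕ} {s : ℕ → U}
    (hs : ∀ j ≤ N, T.dist r (s j) = j) (hsadj : ∀ j < N, T.Adj (s j) (s (j + 1))) :
    IsPath (T.induce (s '' Set.Iic N)) := by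
  apply isPath_induce_image
  · intro i j hi hj h
    rw [← hs i hi, h, hs j hj]
  · intro i j hij hj
    constructor
    · intro h
      have := dist_le_dist_add_one hT r _ _ h
      rw [hs i (by omega), hs j hj] at this
      omega
    · rintro rfl
      exact hsadj i (by omega)

/-- A geodesic `s 0, …, s N` from `r` with both ends in `W`, whose vertices at the well separated
indices `idx t` have a second neighbour `q t` on the next level. The leg `x t` starts at `q t`, is
dominated by `q t` and ends in `W`. -/
structure IsBranchedGeodesic (T : SimpleGraph U) (W : Set U) (r : U) (N : ℕ) (s : ℕ → U) {h : ℕ}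
    (idx : Fin h → ℕ) (q : Fin h → U) (m : Fin h → ℕ) (x : Fin h → ℕ → U) : Prop where
  conn : T.Connected
  zero : s 0 = r
  root_mem : r ∈ W
  last_mem : s N ∈ W
  dist_eq : ∀ j ≤ N, T.dist r (s j) = j
  adj : ∀ j < N, T.Adj (s j) (s (j + 1))
  idx_pos : ∀ t, 1 ≤ idx t
  idx_lt : ∀ t, idx t < N
  separated : ∀ t t', t ≠ t' → idx t + 3 ≤ idx t' ∨ idx t' + 3 ≤ idx t
  adj_branch : ∀ t, T.Adj (s (idx t)) (q t)
  dist_branch : ∀ t, T.dist r (q t) = idx t + 1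
  branch_ne : ∀ t, q t ≠ s (idx t + 1)
  leg_zero : ∀ t, x t 0 = q t
  leg_mem : ∀ t, x t (m t) ∈ W
  leg_dom : ∀ t, ∀ b ≤ m t, Dominates T r (q t) (x t b)
  leg_dist : ∀ t, ∀ b ≤ m t, T.dist r (x t b) = idx t + 1 + b
  leg_adj : ∀ t, ∀ b < m t, T.Adj (x t b) (x t (b + 1))

namespace IsBranchedGeodesic

variable {N h : ℕ} {s : ℕ → U} {idx : Fin h → ℕ} {q : Fin h → U} {m : Fin h → ℕ}
  {x : Fin h → ℕ → U}

theorem comp (H : IsBranchedGeodesic T W r N s idx q m x) {k : ℕ} {g : Fin k → Fin h}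
    (hg : Function.Injective g) :
    IsBranchedGeodesic T W r N s (idx ∘ g) (q ∘ g) (m ∘ g) (x ∘ g) where
  conn := H.conn
  zero := H.zero
  root_mem := H.root_mem
  last_mem := H.last_mem
  dist_eq := H.dist_eq
  adj := H.adj
  idx_pos _ := H.idx_pos _
  idx_lt _ := H.idx_lt _
  separated _ _ ht := H.separated _ _ (hg.ne ht)
  adj_branch _ := H.adj_branch _
  dist_branch _ := H.dist_branch _
  branch_ne _ := H.branch_ne _
  leg_zero _ := H.leg_zero _
  leg_mem _ := H.leg_mem _
  leg_dom _ := H.leg_dom _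
  leg_dist _ := H.leg_dist _
  leg_adj _ := H.leg_adj _

theorem idx_injective (H : IsBranchedGeodesic T W r N s idx q m x) : Function.Injective idx := by
  intro t t' h
  by_contra hne
  have := H.separated t t' hne
  omega

theorem branch_ne_spine (H : IsBranchedGeodesic T W r N s idx q m x) (t : Fin h) {j : ℕ}
    (hj : j ≤ N) : q t ≠ s j := by
  intro heq
  have h1 := H.dist_branch t
  rw [heq, H.dist_eq j hj] at h1
  subst h1
  exact H.branch_ne t heq

/-- The geodesic itself reaches each of its vertices without meeting `q t`. -/
theorem not_dominates_spine (H : IsBranchedGeodesic T W r N s idx q m x) (t : Fin h) {j : ℕ}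
    (hj : j ≤ N) : ¬ Dominates T r (q t) (s j) := by
  induction j with
  | zero =>
    rw [H.zero]
    apply not_dominates_root
    rw [← H.zero]
    exact H.branch_ne_spine t hj
  | succ j ih =>
    exact fun hd => ih (by omega)
      (hd.adj (H.branch_ne_spine t hj).symm (H.adj j (by omega)).symm)

theorem not_dominates_branch (H : IsBranchedGeodesic T W r N s idx q m x) {t t' : Fin h}
    (ht : t ≠ t') : ¬ Dominates T r (q t) (q t') := by
  intro hd
  refine H.not_dominates_spine t (H.idx_lt t').le (hd.adj ?_ (H.adj_branch t').symm)
  intro heq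
  have h1 := H.dist_branch t
  rw [← heq, H.dist_branch t'] at h1
  have := H.separated t t' ht
  omega

theorem not_dominates_leg (H : IsBranchedGeodesic T W r N s idx q m x) {t t' : Fin h}
    (ht : t ≠ t') {b : ℕ} (hb : b ≤ m t') : ¬ Dominates T r (q t) (x t' b) := by
  intro hd
  rcases dominates_or_dominates H.conn hd (H.leg_dom t' b hb) with h | h
  · exact H.not_dominates_branch ht h
  · exact H.not_dominates_branch ht.symm h

theorem leg_ne_spine (H : IsBranchedGeodesic T W r N s idx q m x) (t : Fin h) {b j : ℕ}
    (hb : b ≤ m t) (hj : j ≤ N) : x t b ≠ s j :=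
  fun heq => H.not_dominates_spine t hj (heq ▸ H.leg_dom t b hb)

theorem leg_ne_leg (H : IsBranchedGeodesic T W r N s idx q m x) {t t' : Fin h}
    (ht : t ≠ t') {b b' : ℕ} (hb : b ≤ m t) (hb' : b' ≤ m t') : x t b ≠ x t' b' :=
  fun heq => H.not_dominates_leg ht hb' (heq ▸ H.leg_dom t b hb)

theorem dominates_of_adj_leg (H : IsBranchedGeodesic T W r N s idx q m x) {t : Fin h} {b : ℕ}
    (hb : b ≤ m t) (hb0 : b ≠ 0) {z : U} (hz : T.Adj (x t b) z) : Dominates T r (q t) z := by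
  refine (H.leg_dom t b hb).adj (fun heq => ?_) hz
  have h1 := H.leg_dist t b hb
  rw [heq, H.dist_branch] at h1
  omega

theorem not_adj_leg_leg (H : IsBranchedGeodesic T W r N s idx q m x) {t t' : Fin h}
    (ht : t ≠ t') {b b' : ℕ} (hb : b ≤ m t) (hb' : b' ≤ m t') :
    ¬ T.Adj (x t b) (x t' b') := by
  intro hadj
  by_cases hb0 : b = 0
  · by_cases hb0' : b' = 0
    · subst hb0 hb0'
      have h1 := dist_le_dist_add_one H.conn r _ _ hadj
      have h2 := dist_le_dist_add_one H.conn r _ _ hadj.symm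
      rw [H.leg_dist t 0 hb, H.leg_dist t' 0 hb'] at h1 h2
      have := H.separated t t' ht
      omega
    · exact H.not_dominates_leg ht.symm hb (H.dominates_of_adj_leg hb' hb0' hadj.symm)
  · exact H.not_dominates_leg ht hb' (H.dominates_of_adj_leg hb hb0 hadj)

theorem adj_leg_spine (H : IsBranchedGeodesic T W r N s idx q m x) {t : Fin h} {b j : ℕ}
    (hb : b ≤ m t) (hj : j ≤ N) (hadj : T.Adj (x t b) (s j)) :
    b = 0 ∧ T.Adj (q t) (s j) ∧ idx t ≤ j ∧ j ≤ idx t + 2 := by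
  have hb0 : b = 0 := by
    by_contra hb0
    exact H.not_dominates_spine t hj (H.dominates_of_adj_leg hb hb0 hadj)
  subst hb0
  have h1 := dist_le_dist_add_one H.conn r _ _ hadj
  have h2 := dist_le_dist_add_one H.conn r _ _ hadj.symm
  rw [H.leg_dist t 0 hb, H.dist_eq j hj] at h1 h2
  rw [H.leg_zero] at hadj
  exact ⟨rfl, hadj, by omega, by omega⟩

/-- Branch vertices with a single neighbour on the geodesic yield a caterpillar. -/
theorem hasConnectifier_of_pendant (H : IsBranchedGeodesic T W r N s idx q m x) (hh : 0 < h)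
    (h1 : ∀ t, ¬ T.Adj (q t) (s (idx t + 1)))
    (h2 : ∀ t, ¬ (idx t + 2 ≤ N ∧ T.Adj (q t) (s (idx t + 2)))) :
    HasConnectifier T W (h + 2) := by
  have hN := H.idx_lt ⟨0, hh⟩
  have hN0 := H.idx_pos ⟨0, hh⟩
  obtain ⟨n, rfl⟩ : ∃ n, N = n + 1 := ⟨N - 1, by omega⟩
  refine hasConnectifier_of_caterpillar (n := n) (l := m) (d := T.dist r) (s := s) (y := x) hh
    (a := fun t => ⟨idx t - 1, by have := H.idx_pos t; have := H.idx_lt t; omega⟩) ?_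
    (dist_le_dist_add_one H.conn r) H.dist_eq (fun j hj => H.adj j (by omega)) ?_
    H.leg_adj ?_ ?_
    (fun t t' ht b hb b' hb' => ⟨H.leg_ne_leg ht hb hb', H.not_adj_leg_leg ht hb hb'⟩)
    (H.zero ▸ H.root_mem) H.last_mem H.leg_mem
  · intro t t' heq
    have := Fin.mk.inj_iff.1 heq
    have := H.idx_pos t
    have := H.idx_pos t'
    exact H.idx_injective (by omega)
  · intro t b hb
    have := H.idx_pos t
    rw [H.leg_dist t b hb]
    change _ = idx t - 1 + 2 + b
    omega
  · intro t
    change T.Adj _ (s (idx t - 1 + 1))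
    rw [Nat.sub_add_cancel (H.idx_pos t), H.leg_zero]
    exact (H.adj_branch t).symm
  · intro t b hb j hj
    refine ⟨H.leg_ne_spine t hb hj, fun hadj => ?_⟩
    obtain ⟨hb0, hq, hj1, hj2⟩ := H.adj_leg_spine hb hj hadj
    refine ⟨hb0, ?_⟩
    change j = idx t - 1 + 1
    rw [Nat.sub_add_cancel (H.idx_pos t)]
    by_contra hne
    obtain rfl | rfl : j = idx t + 1 ∨ j = idx t + 2 := by omega
    · exact h1 t hq
    · exact h2 t ⟨hj, hq⟩

/-- Branch vertices forming a triangle with an edge of the geodesic yield the line graph of a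
caterpillar. -/
theorem hasConnectifier_of_triangle (H : IsBranchedGeodesic T W r N s idx q m x) (hh : 0 < h)
    (h1 : ∀ t, T.Adj (q t) (s (idx t + 1)))
    (h2 : ∀ t, ¬ (idx t + 2 ≤ N ∧ T.Adj (q t) (s (idx t + 2)))) :
    HasConnectifier T W (h + 2) := by
  refine hasConnectifier_of_caterpillar_lineGraph (n := N) (l := m) (d := T.dist r) (s := s)
    (y := x) hh (a := fun t => ⟨idx t, H.idx_lt t⟩)
    (fun t t' heq => H.idx_injective (Fin.mk.inj_iff.1 heq))
    (dist_le_dist_add_one H.conn r) H.dist_eq H.adj H.leg_dist H.leg_adj ?_ ?_ ?_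
    (fun t t' ht b hb b' hb' => ⟨H.leg_ne_leg ht hb hb', H.not_adj_leg_leg ht hb hb'⟩)
    (H.zero ▸ H.root_mem) H.last_mem H.leg_mem
  · intro t
    rw [H.leg_zero]
    exact (H.adj_branch t).symm
  · intro t
    rw [H.leg_zero]
    exact h1 t
  · intro t b hb j hj
    refine ⟨H.leg_ne_spine t hb hj, fun hadj => ?_⟩
    obtain ⟨hb0, hq, hj1, hj2⟩ := H.adj_leg_spine hb hj hadj
    refine ⟨hb0, ?_⟩
    change j = idx t ∨ j = idx t + 1
    by_contra hne
    obtain rfl : j = idx t + 2 := by omega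
    exact h2 t ⟨hj, hq⟩

open Classical in
/-- The spine rerouted through the branch vertices `q t`, which replace the vertices
`s (idx t + 1)`. -/
noncomputable def reroute {h : ℕ} (s : ℕ → U) (idx : Fin h → ℕ) (q : Fin h → U) (j : ℕ) : U :=
  if hj : ∃ t, idx t + 1 = j then q hj.choose else s j

theorem reroute_branch (H : IsBranchedGeodesic T W r N s idx q m x) (t : Fin h) :
    reroute s idx q (idx t + 1) = q t := by
  have hj : ∃ t', idx t' + 1 = idx t + 1 := ⟨t, rfl⟩
  rw [reroute, dif_pos hj]
  congr 1
  have := hj.choose_spec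
  exact H.idx_injective (by omega)

theorem reroute_of_ne {j : ℕ} (hj : ∀ t, idx t + 1 ≠ j) : reroute s idx q j = s j :=
  dif_neg fun ⟨t, ht⟩ => hj t ht

theorem reroute_cases (H : IsBranchedGeodesic T W r N s idx q m x) (j : ℕ) :
    (∃ t, j = idx t + 1 ∧ reroute s idx q j = q t) ∨
      ((∀ t, idx t + 1 ≠ j) ∧ reroute s idx q j = s j) := by
  by_cases hj : ∃ t, idx t + 1 = j
  · obtain ⟨t, rfl⟩ := hj
    exact Or.inl ⟨t, rfl, H.reroute_branch t⟩
  · push Not at hj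
    exact Or.inr ⟨hj, reroute_of_ne hj⟩

theorem dist_reroute (H : IsBranchedGeodesic T W r N s idx q m x) {j : ℕ} (hj : j ≤ N) :
    T.dist r (reroute s idx q j) = j := by
  rcases H.reroute_cases j with ⟨t, rfl, h⟩ | ⟨-, h⟩
  · rw [h, H.dist_branch]
  · rw [h, H.dist_eq j hj]

theorem adj_reroute (H : IsBranchedGeodesic T W r N s idx q m x)
    (h2 : ∀ t, idx t + 2 ≤ N ∧ T.Adj (q t) (s (idx t + 2))) {j : ℕ} (hj : j < N) :
    T.Adj (reroute s idx q j) (reroute s idx q (j + 1)) := by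
  rcases H.reroute_cases (j + 1) with ⟨t', ht', h'⟩ | ⟨-, h'⟩ <;>
    rcases H.reroute_cases j with ⟨t, rfl, h⟩ | ⟨-, h⟩
  · by_cases htt : t = t'
    · subst htt
      omega
    · have := H.separated t t' htt
      omega
  · obtain rfl : j = idx t' := by omega
    rw [h, h']
    exact H.adj_branch t'
  · rw [h, h']
    exact (h2 t).2
  · rw [h, h']
    exact H.adj j hj

/-- If the branch vertices return to the geodesic after two steps, it can be rerouted through them,
and what remains of the legs is attached to a single vertex of the new geodesic. -/
theorem hasConnectifier_of_reroute (H : IsBranchedGeodesic T W r N s idx q m x) (hh : 0 < h)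
    (h2 : ∀ t, idx t + 2 ≤ N ∧ T.Adj (q t) (s (idx t + 2))) (hm : ∀ t, m t ≠ 0) :
    HasConnectifier T W (h + 2) := by
  have hN := H.idx_lt ⟨0, hh⟩
  obtain ⟨n, rfl⟩ : ∃ n, N = n + 1 := ⟨N - 1, by omega⟩
  refine hasConnectifier_of_caterpillar (n := n) (l := fun t => m t - 1) (d := T.dist r)
    (s := reroute s idx q) (y := fun t b => x t (b + 1)) hh
    (a := fun t => ⟨idx t, by have := (h2 t).1; omega⟩)
    (fun t t' heq => H.idx_injective (Fin.mk.inj_iff.1 heq))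
    (dist_le_dist_add_one H.conn r) (fun j hj => H.dist_reroute hj)
    (fun j hj => H.adj_reroute h2 (by omega)) ?_ ?_ ?_ ?_ ?_ ?_ ?_ ?_
  · intro t b hb
    have := hm t
    rw [H.leg_dist t _ (by omega)]
    change _ = idx t + 2 + b
    omega
  · intro t b hb
    exact H.leg_adj t _ (by omega)
  · intro t
    change T.Adj _ (reroute s idx q (idx t + 1))
    rw [H.reroute_branch, ← H.leg_zero]
    exact (H.leg_adj t 0 (by have := hm t; omega)).symm
  · intro t b hb j hj
    have hbm : b + 1 ≤ m t := by
      have := hm t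
      omega
    have key : Dominates T r (q t) (reroute s idx q j) → j = idx t + 1 := by
      intro hd
      rcases H.reroute_cases j with ⟨t', rfl, h⟩ | ⟨-, h⟩
      · by_cases htt : t = t'
        · rw [htt]
        · rw [h] at hd
          exact absurd hd (H.not_dominates_branch htt)
      · rw [h] at hd
        exact absurd hd (H.not_dominates_spine t hj)
    have hdist : T.dist r (x t (b + 1)) = idx t + 1 + (b + 1) := H.leg_dist t _ hbm
    constructor
    · intro heq
      have hj' := key (heq ▸ H.leg_dom t _ hbm)
      rw [heq, H.dist_reroute hj] at hdist
      omega
    · intro hadj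
      have hj' := key (H.dominates_of_adj_leg hbm (by omega) hadj)
      have h1 := dist_le_dist_add_one H.conn r _ _ hadj.symm
      rw [hdist, H.dist_reroute hj] at h1
      refine ⟨by omega, hj'⟩
  · intro t t' ht b hb b' hb'
    have := hm t
    have := hm t'
    exact ⟨H.leg_ne_leg ht (by omega) (by omega), H.not_adj_leg_leg ht (by omega) (by omega)⟩
  · rw [reroute_of_ne (fun t => by omega), H.zero]
    exact H.root_mem
  · rw [reroute_of_ne (fun t => by have := (h2 t).1; omega)]
    exact H.last_mem
  · intro t
    have := hm t
    change x t (m t - 1 + 1) ∈ W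
    rw [Nat.sub_add_cancel (by omega)]
    exact H.leg_mem t

/-- If the legs consist of the branch vertices only, then the rerouted geodesic itself passes
through many vertices of `W`. -/
theorem exists_isPath_of_reroute [Finite U] (H : IsBranchedGeodesic T W r N s idx q m x)
    (h2 : ∀ t, idx t + 2 ≤ N ∧ T.Adj (q t) (s (idx t + 2))) (hm : ∀ t, m t = 0) :
    ∃ P : Set U, IsPath (T.induce P) ∧ h ≤ (W ∩ P).ncard := by
  refine ⟨reroute s idx q '' Set.Iic N, isPath_of_geodesic H.conn
    (fun j hj => H.dist_reroute hj) (fun j hj => H.adj_reroute h2 hj), ?_⟩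
  have hq : Function.Injective q := by
    intro t t' heq
    have := H.dist_branch t
    rw [heq, H.dist_branch t'] at this
    exact H.idx_injective (by omega)
  refine (ncard_range_fin hq).symm.le.trans (Set.ncard_le_ncard ?_ (Set.toFinite _))
  rintro _ ⟨t, rfl⟩
  refine ⟨?_, idx t + 1, (H.idx_lt t), H.reroute_branch t⟩
  have := H.leg_mem t
  rwa [hm, H.leg_zero] at this

end IsBranchedGeodesic

end Geodesic

/-! ### The dichotomy for a connected graph -/

/-- A connected graph with sufficiently many marked vertices, among them all vertices that are not
cut vertices, has an induced path through many marked vertices or an induced subgraph of one of the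
four types whose simplicial vertices all lie in `W`. The number `25 * h + 1` of events allows for
fewer than `h` marked vertices, the root, and `h` branchings in each of `24` classes. -/
theorem exists_isPath_or_hasConnectifier {U : Type*} [Finite U] {T : SimpleGraph U} {W A : Set U}
    (hT : T.Connected) (hW : ContainsNoncut T W) (hWA : W ⊆ A) {h : ℕ} (hh : 3 ≤ h)
    (hA : eventBound (2 ^ (h + h)) (25 * h + 1) ≤ A.ncard) :
    (∃ P : Set U, IsPath (T.induce P) ∧ h ≤ (A ∩ P).ncard) ∨ HasConnectifier T W h := by
  classical
  by_cases hdeg : ∃ v, 2 ^ (h + h) ≤ (T.neighborSet v).ncard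
  · obtain ⟨v, hv⟩ := hdeg
    exact Or.inr (hasConnectifier_of_degree hT hW hh v hv)
  push Not at hdeg
  obtain ⟨r, hr⟩ : W.Nonempty := by
    have h2 : 1 < A.ncard := by
      simp only [eventBound] at hA
      omega
    obtain ⟨u, -, v, -, huv⟩ := (Set.one_lt_ncard (Set.toFinite A)).1 h2
    obtain ⟨m, x, -, hx, -⟩ := hW.exists_leg hT huv
    exact ⟨_, hx⟩
  obtain ⟨N, s, E, h0, hs, hN, hE, hev⟩ := exists_geodesic_events (T := T) (r := r) A
    (fun v => (hdeg v).le) (25 * h + 1) r (by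
      rwa [Set.eq_univ_of_forall (s := {x | Relation.ReflTransGen (StepUp T r) r x})
        (reflTransGen_stepUp hT), Set.inter_univ])
  have hdist : ∀ j ≤ N, T.dist r (s j) = j := by
    intro j
    induction j with
    | zero => simp [h0]
    | succ j ih =>
      intro hj
      rw [(hs j (by omega)).2, ih (by omega)]
  have hadj : ∀ j < N, T.Adj (s j) (s (j + 1)) := fun j hj => (hs j hj).1
  by_cases hEA : h ≤ (E.filter fun j => s j ∈ A).card
  · refine Or.inl ⟨_, isPath_of_geodesic hT hdist hadj, ?_⟩
    refine hEA.trans ?_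
    rw [← Set.ncard_coe_finset]
    refine Set.ncard_le_ncard_of_injOn s ?_ ?_ (Set.toFinite _)
    · intro j hj
      obtain ⟨hj, hjA⟩ := Finset.mem_filter.1 hj
      exact ⟨hjA, j, (hev j hj).1, rfl⟩
    · intro i hi j hj hij
      rw [← hdist i (hev i (Finset.mem_filter.1 hi).1).1, hij,
        hdist j (hev j (Finset.mem_filter.1 hj).1).1]
  let B := (E.filter fun j => s j ∉ A).erase 0
  have hB : 24 * h ≤ B.card := by
    have h1 := Finset.card_filter_add_card_filter_not (s := E) fun j => s j ∈ A
    have h2 := Finset.pred_card_le_card_erase (s := E.filter fun j => s j ∉ A) (a := 0)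
    change _ ≤ B.card at h2
    omega
  have hB' : ∀ j ∈ B, 1 ≤ j ∧ j < N ∧ ∃ q, StepUp T r (s j) q ∧ q ≠ s (j + 1) := by
    intro j hj
    obtain ⟨hj0, hj⟩ := Finset.mem_erase.1 hj
    obtain ⟨hj, hjA⟩ := Finset.mem_filter.1 hj
    have h1 := (hev j hj).2.resolve_left hjA
    exact ⟨by omega, h1⟩
  have hbranch : ∀ j, ∃ (q : U) (m : ℕ) (x : ℕ → U), j ∈ B → StepUp T r (s j) q ∧
      q ≠ s (j + 1) ∧ x 0 = q ∧ x m ∈ W ∧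
      (∀ k ≤ m, Dominates T r q (x k) ∧ T.dist r (x k) = T.dist r q + k) ∧
      ∀ k < m, T.Adj (x k) (x (k + 1)) := by
    intro j
    by_cases hj : j ∈ B
    · obtain ⟨-, -, q, hq, hqs⟩ := hB' j hj
      have hqr : q ≠ r := by
        rintro rfl
        have := hq.2
        simp at this
      obtain ⟨m, x, hx⟩ := hW.exists_leg hT hqr
      exact ⟨q, m, x, fun _ => ⟨hq, hqs, hx⟩⟩
    · exact ⟨r, 0, fun _ => r, fun h => absurd h hj⟩
  choose q m x hx using hbranch
  -- The indices are sorted by their residue modulo three, which separates them, by the adjacencies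
  -- of `q j` to the geodesic and by whether the leg is trivial.
  let κ : ℕ → Fin 3 × Bool × Bool × Bool := fun j =>
    (⟨j % 3, Nat.mod_lt _ (by omega)⟩, decide (T.Adj (q j) (s (j + 1))),
      decide (j + 2 ≤ N ∧ T.Adj (q j) (s (j + 2))), decide (m j = 0))
  obtain ⟨c, -, hc⟩ := Finset.exists_le_card_fiber_of_mul_le_card_of_maps_to
    (s := B) (t := Finset.univ) (f := κ) (n := h) (fun _ _ => Finset.mem_univ _)
    Finset.univ_nonempty (by simpa using hB)
  obtain ⟨I, hI, hIc⟩ := Finset.exists_subset_card_eq hc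
  let e := I.equivFinOfCardEq hIc
  let idx : Fin h → ℕ := fun t => e.symm t
  have hidx : ∀ t, idx t ∈ B ∧ κ (idx t) = c := fun t =>
    Finset.mem_filter.1 (hI (e.symm t).2)
  have hinj : Function.Injective idx := fun t t' htt => e.symm.injective (Subtype.ext htt)
  have H : IsBranchedGeodesic T W r N s idx (q ∘ idx) (m ∘ idx) (x ∘ idx) :=
    { conn := hT
      zero := h0
      root_mem := hr
      last_mem := by
        refine hW.mem_of_leaf hT (r := r) ?_ fun u hu hu' => hN u ⟨hu, hu'⟩
        intro heq
        have h1 := hdist N le_rfl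
        rw [← heq, dist_self] at h1
        have h2 := (hB' _ (hidx ⟨0, by omega⟩).1).2.1
        omega
      dist_eq := hdist
      adj := hadj
      idx_pos := fun t => (hB' _ (hidx t).1).1
      idx_lt := fun t => (hB' _ (hidx t).1).2.1
      separated := by
        intro t t' htt
        have h1 : idx t % 3 = idx t' % 3 :=
          congrArg (fun c : Fin 3 × Bool × Bool × Bool => (c.1 : ℕ))
            ((hidx t).2.trans (hidx t').2.symm)
        have h2 := hinj.ne htt
        omega
      adj_branch := fun t => (hx _ (hidx t).1).1.1
      dist_branch := fun t => by
        rw [Function.comp_apply, (hx _ (hidx t).1).1.2, hdist _ (hB' _ (hidx t).1).2.1.le]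
      branch_ne := fun t => (hx _ (hidx t).1).2.1
      leg_zero := fun t => (hx _ (hidx t).1).2.2.1
      leg_mem := fun t => (hx _ (hidx t).1).2.2.2.1
      leg_dom := fun t b hb => ((hx _ (hidx t).1).2.2.2.2.1 b hb).1
      leg_dist := fun t b hb => by
        rw [Function.comp_apply, ((hx _ (hidx t).1).2.2.2.2.1 b hb).2, (hx _ (hidx t).1).1.2,
          hdist _ (hB' _ (hidx t).1).2.1.le]
      leg_adj := fun t => (hx _ (hidx t).1).2.2.2.2.2 }
  have hκ : ∀ t, (decide (T.Adj (q (idx t)) (s (idx t + 1))) = c.2.1) ∧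
      (decide (idx t + 2 ≤ N ∧ T.Adj (q (idx t)) (s (idx t + 2))) = c.2.2.1) ∧
      decide (m (idx t) = 0) = c.2.2.2 := by
    intro t
    have := (hidx t).2
    exact ⟨congrArg (fun c => c.2.1) this, congrArg (fun c => c.2.2.1) this,
      congrArg (fun c => c.2.2.2) this⟩
  -- The two ends of the geodesic provide two of the simplicial vertices, so `h - 2` legs remain.
  obtain ⟨k, rfl⟩ : ∃ k, h = k + 2 := ⟨h - 2, by omega⟩
  have hk : 0 < k := by omega
  have H' := H.comp (Fin.castAdd_injective k 2)
  by_cases h2 : c.2.2.1 = true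
  · have hC : ∀ t, idx t + 2 ≤ N ∧ T.Adj (q (idx t)) (s (idx t + 2)) := fun t =>
      of_decide_eq_true ((hκ t).2.1.trans h2)
    by_cases h3 : c.2.2.2 = true
    · obtain ⟨P, hP, hc⟩ := H.exists_isPath_of_reroute hC
        fun t => of_decide_eq_true ((hκ t).2.2.trans h3)
      exact Or.inl ⟨P, hP, hc.trans (Set.ncard_le_ncard (Set.inter_subset_inter_left P hWA)
        (Set.toFinite _))⟩
    · exact Or.inr (H'.hasConnectifier_of_reroute hk (fun t => hC _) fun t =>
        of_decide_eq_false ((hκ _).2.2.trans (Bool.eq_false_iff.2 h3)))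
  · have hC : ∀ t, ¬ (idx t + 2 ≤ N ∧ T.Adj (q (idx t)) (s (idx t + 2))) := fun t =>
      of_decide_eq_false ((hκ t).2.1.trans (Bool.eq_false_iff.2 h2))
    by_cases h1 : c.2.1 = true
    · exact Or.inr (H'.hasConnectifier_of_triangle hk
        (fun t => of_decide_eq_true ((hκ _).1.trans h1)) fun t => hC _)
    · exact Or.inr (H'.hasConnectifier_of_pendant hk
        (fun t => of_decide_eq_false ((hκ _).1.trans (Bool.eq_false_iff.2 h1))) fun t => hC _)

/-! ### Transfer to induced subgraphs -/

section Transfer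

variable {V : Type*} {G : SimpleGraph V}

theorem isPath_induce_image_val {S : Set V} {P : Set S} (h : IsPath ((G.induce S).induce P)) :
    IsPath (G.induce (Subtype.val '' P)) := by
  let f : (G.induce S).induce P ↪g G := (Embedding.induce S).comp (Embedding.induce P)
  have hf : Subtype.val '' P = Set.range f := by
    ext v
    constructor
    · rintro ⟨u, hu, rfl⟩
      exact ⟨⟨u, hu⟩, rfl⟩
    · rintro ⟨u, rfl⟩
      exact ⟨u.1, u.2, rfl⟩
  rw [hf]
  exact isPath_congr f.isoInduceRange h

theorem image_simplicialVertices_induce_range {β : Type*} {M : SimpleGraph β} (f : M ↪g G) :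
    Subtype.val '' simplicialVertices (G.induce (Set.range f)) = f '' simplicialVertices M := by
  have key : ∀ z, (⟨f z, z, rfl⟩ : Set.range f) ∈ simplicialVertices (G.induce (Set.range f)) ↔
      z ∈ simplicialVertices M := by
    intro z
    rw [mem_simplicialVertices_iff, mem_simplicialVertices_iff]
    constructor
    · intro h x y hx hy hxy
      have := h ⟨f x, x, rfl⟩ ⟨f y, y, rfl⟩ (f.map_adj_iff.2 hx) (f.map_adj_iff.2 hy)
        fun e => hxy (f.injective (congrArg Subtype.val e))
      exact f.map_adj_iff.1 this
    · rintro h ⟨_, x, rfl⟩ ⟨_, y, rfl⟩ hx hy hxy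
      exact f.map_adj_iff.2 (h x y (f.map_adj_iff.1 hx) (f.map_adj_iff.1 hy)
        fun e => hxy (by subst e; rfl))
  ext v
  constructor
  · rintro ⟨⟨_, z, rfl⟩, hz, rfl⟩
    exact ⟨z, (key z).1 hz, rfl⟩
  · rintro ⟨z, hz, rfl⟩
    exact ⟨_, (key z).2 hz, rfl⟩

/-- In an inclusion-minimal connected set `S` of vertices that meets the neighbourhood of every
vertex of `Y`, every vertex other than a cut vertex is the only neighbour in `S` of some vertex of
`Y`. -/
theorem containsNoncut_of_minimal [Finite V] {Y S : Set V}
    (hcov : ∀ y ∈ Y, ∃ v ∈ S, G.Adj y v)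
    (hmin : ∀ S' ⊂ S, (G.induce S').Connected → ∃ y ∈ Y, ∀ v ∈ S', ¬ G.Adj y v) :
    ContainsNoncut (G.induce S)
      {w | ∃ y ∈ Y, G.Adj y w ∧ ∀ v ∈ S, G.Adj y v → v = w} := by
  intro r w hrw hdom
  have hconn : (G.induce (S \ {w.1})).Connected := by
    refine induce_connected_of_patches r.1 ⟨r.2, fun e => hrw (Subtype.ext e)⟩ ?_
    rintro v ⟨hvS, hvw⟩
    have hnd : ¬ Dominates (G.induce S) r w ⟨v, hvS⟩ := fun hd =>
      hvw (congrArg Subtype.val (hdom _ hd))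
    obtain ⟨p, hp⟩ := not_forall.1 hnd
    let p' : G.Walk r.1 v := p.map (Embedding.induce S).toHom
    refine ⟨{u | u ∈ p'.support}, ?_, p'.start_mem_support, p'.end_mem_support,
      (p'.connected_induce_support).preconnected _ _⟩
    intro u hu
    have hu' : u ∈ (p.map (Embedding.induce S).toHom).support := hu
    rw [Walk.support_map, List.mem_map] at hu'
    obtain ⟨u, hup, rfl⟩ := hu'
    exact ⟨u.2, fun e => hp (Subtype.ext (a1 := u) (a2 := w) e ▸ hup)⟩
  obtain ⟨y, hy, hyS⟩ := hmin (S \ {w.1})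
    ((Set.ssubset_iff_of_subset Set.sdiff_subset).2 ⟨w, w.2, fun h => h.2 rfl⟩) hconn
  have huniq : ∀ v ∈ S, G.Adj y v → v = w := by
    intro v hv hadj
    by_contra hne
    exact hyS v ⟨hv, hne⟩ hadj
  obtain ⟨v, hv, hadj⟩ := hcov y hy
  exact ⟨y, hy, huniq v hv hadj ▸ hadj, huniq⟩

theorem exists_isPath_of_two {Y : Set V} (hT : (G.induce Yᶜ).Connected) {u v : V} (hu : u ∉ Y)
    (hv : v ∉ Y) : ∃ H ⊆ Yᶜ, IsPath (G.induce H) ∧ u ∈ H ∧ v ∈ H := by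
  have hdom : Dominates (G.induce Yᶜ) ⟨u, hu⟩ ⟨u, hu⟩ ⟨v, hv⟩ := fun p => p.start_mem_support
  obtain ⟨m, x, h0, hm, hx, hadj⟩ := hdom.exists_geodesic hT
  refine ⟨_, ?_, isPath_induce_image_val (isPath_of_geodesic (s := x) (r := ⟨u, hu⟩) hT
    (fun j hj => ?_) hadj),
    ?_, ?_⟩
  · rintro _ ⟨z, -, rfl⟩
    exact z.2
  · rw [(hx j hj).2, dist_self, zero_add]
  · exact ⟨_, ⟨0, Nat.zero_le _, h0⟩, rfl⟩
  · exact ⟨_, ⟨m, Set.mem_Iic.2 le_rfl, hm⟩, rfl⟩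

end Transfer

end Connectifier

theorem mainTheorem7 (h : ℕ) (hh : 1 ≤ h) :
    ∃ μ : ℕ, 1 ≤ μ ∧
      ∀ (V : Type*) [Finite V] (G : SimpleGraph V) (Y : Set V),
        G.Connected →
        μ ≤ Y.ncard →
        (G.induce Yᶜ).Connected →
        (∀ y ∈ Y, ∃ v, v ∉ Y ∧ G.Adj y v) →
        ∃ Y' : Set V, Y' ⊆ Y ∧ Y'.ncard = h ∧
          ∃ H : Set V, H ⊆ Yᶜ ∧
            ((Connectifier.IsPath (G.induce H) ∧ ∀ y ∈ Y', ∃ v ∈ H, G.Adj y v) ∨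
             ((Connectifier.IsCaterpillar (G.induce H) ∨
               Connectifier.IsLineGraphOfCaterpillar (G.induce H) ∨
               Connectifier.IsSubdividedStar (G.induce H) ∨
               Connectifier.IsLineGraphOfSubdividedStar (G.induce H)) ∧
              (∀ y ∈ Y', ∃! v, v ∈ H ∧ G.Adj y v) ∧
              {v | v ∈ H ∧ ∃ y ∈ Y', G.Adj y v} =
                Subtype.val '' Connectifier.simplicialVertices (G.induce H))) := by
  classical
  rcases Nat.lt_or_ge h 3 with hlt | hge
  · refine ⟨2, by omega, fun V _ G Y _ hY hconn hnbr => ?_⟩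
    obtain ⟨y, hy, z, hz, hyz⟩ := (Set.one_lt_ncard (Set.toFinite Y)).1 (show 1 < Y.ncard from hY)
    obtain ⟨u, hu, hyu⟩ := hnbr y hy
    obtain ⟨v, hv, hzv⟩ := hnbr z hz
    obtain ⟨H, hH, hpath, huH, hvH⟩ := Connectifier.exists_isPath_of_two hconn hu hv
    obtain ⟨Y', hY', hcard⟩ := Set.exists_subset_card_eq (s := {y, z}) (n := h)
      (by rw [Set.ncard_pair hyz]; omega)
    refine ⟨Y', fun a ha => ?_, hcard, H, hH, Or.inl ⟨hpath, fun a ha => ?_⟩⟩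
    · rcases hY' ha with rfl | rfl
      · exact hy
      · exact hz
    · rcases hY' ha with rfl | rfl
      · exact ⟨u, huH, hyu⟩
      · exact ⟨v, hvH, hzv⟩
  refine ⟨h * Connectifier.eventBound (2 ^ (h + h)) (25 * h + 1) + 1, by omega,
    fun V _ G Y _ hY hconn hnbr => ?_⟩
  -- The set `S` is a connected subset of `Yᶜ` that meets all neighbourhoods of vertices of `Y`,
  -- and it has minimum size.
  obtain ⟨S, ⟨hSY, hSconn, hScov⟩, hSmin⟩ := Set.exists_min_image
    {S : Set V | S ⊆ Yᶜ ∧ (G.induce S).Connected ∧ ∀ y ∈ Y, ∃ v ∈ S, G.Adj y v} Set.ncard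
    (Set.toFinite _) ⟨Yᶜ, subset_rfl, hconn, hnbr⟩
  have hW := Connectifier.containsNoncut_of_minimal (Y := Y) hScov (by
    intro S' hS' hconn'
    by_contra hcon
    push Not at hcon
    exact (Set.ncard_lt_ncard hS' (Set.toFinite S)).not_ge
      (hSmin S' ⟨hS'.subset.trans hSY, hconn', hcon⟩))
  have : ∀ y : Y, ∃ v : S, G.Adj y v := fun y => by
    obtain ⟨v, hv, hadj⟩ := hScov y y.2
    exact ⟨⟨v, hv⟩, hadj⟩
  choose g hg using this
  by_cases hfib : ∃ v : S, h ≤ {y : Y | g y = v}.ncard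
  · obtain ⟨v, hv⟩ := hfib
    rw [← Set.ncard_image_of_injective _ Subtype.val_injective] at hv
    obtain ⟨Y', hY', hcard⟩ := Set.exists_subset_card_eq hv
    refine ⟨Y', ?_, hcard, Subtype.val '' (((fun _ => v) : ℕ → S) '' Set.Iic 0), ?_,
      Or.inl ⟨Connectifier.isPath_induce_image_val (Connectifier.isPath_induce_image ?_ ?_), ?_⟩⟩
    · intro y hy
      obtain ⟨z, -, rfl⟩ := hY' hy
      exact z.2
    · rintro _ ⟨z, -, rfl⟩
      exact hSY z.2
    · intro i j hi hj _
      omega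
    · intro i j hij hj
      omega
    · intro y hy
      obtain ⟨z, hz, rfl⟩ := hY' hy
      exact ⟨v, ⟨v, ⟨0, by simp, rfl⟩, rfl⟩, (show g z = v from hz) ▸ hg z⟩
  push Not at hfib
  have hA : Connectifier.eventBound (2 ^ (h + h)) (25 * h + 1) ≤ (Set.range g).ncard := by
    have := Fintype.ofFinite Y
    have h1 := Finset.card_le_mul_card_image (f := g) Finset.univ h fun v _ => by
      have := hfib v
      rw [Set.ncard_eq_toFinset_card'] at this
      refine le_trans (le_of_eq ?_) this.le
      congr 1
      ext y
      simp
    rw [Finset.card_univ, ← Nat.card_eq_fintype_card, Nat.card_coe_set_eq] at h1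
    rw [← Set.image_univ, ← Finset.coe_univ, ← Finset.coe_image, Set.ncard_coe_finset]
    exact Nat.le_of_mul_le_mul_left (by omega) (show 0 < h by omega)
  rcases Connectifier.exists_isPath_or_hasConnectifier hSconn hW (A := Set.range g) (by
      rintro w ⟨y, hy, -, hw⟩
      exact ⟨⟨y, hy⟩, Subtype.ext (hw _ (g ⟨y, hy⟩).2 (hg ⟨y, hy⟩))⟩) hge hA with
    ⟨P, hP, hPc⟩ | ⟨β, M, htype, hcard, f, hf⟩
  · obtain ⟨Z, hZ, hZc⟩ := Set.exists_subset_card_eq hPc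
    have hsec : ∀ v : Z, ∃ y : Y, g y = v := fun v => (hZ v.2).1
    choose y hy using hsec
    refine ⟨Set.range fun v => (y v : V), ?_, ?_, Subtype.val '' P, ?_,
      Or.inl ⟨Connectifier.isPath_induce_image_val hP, ?_⟩⟩
    · rintro _ ⟨v, rfl⟩
      exact (y v).2
    · rw [← Set.image_univ, Set.ncard_image_of_injective, Set.ncard_univ, Nat.card_coe_set_eq, hZc]
      intro v v' heq
      have := Subtype.ext heq
      exact Subtype.ext ((hy v).symm.trans ((congrArg g this).trans (hy v')))
    · rintro _ ⟨v, -, rfl⟩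
      exact hSY v.2
    · rintro _ ⟨v, rfl⟩
      exact ⟨v.1, ⟨v.1, (hZ v.2).2, rfl⟩, hy v ▸ hg (y v)⟩
  · have : Nonempty V := ⟨hSconn.nonempty.some.1⟩
    choose! y hyY hyadj hyuniq using hf
    let f' : M ↪g G := (SimpleGraph.Embedding.induce S).comp f
    have hf' : ∀ z, f' z = f z := fun _ => rfl
    have e := f'.isoInduceRange
    have hmem : ∀ z, f' z ∈ S := fun z => (f z).2
    refine ⟨y '' Connectifier.simplicialVertices M, ?_, ?_, Set.range f', ?_,
      Or.inr ⟨?_, ?_, ?_⟩⟩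
    · rintro _ ⟨z, hz, rfl⟩
      exact hyY z hz
    · rw [Set.InjOn.ncard_image, hcard]
      intro z hz z' hz' heq
      refine f'.injective (hyuniq z' hz' _ (hmem z) ?_)
      rw [← heq]
      exact hyadj z hz
    · rintro _ ⟨z, rfl⟩
      exact hSY (hmem z)
    · rcases htype with h1 | ⟨n, C, hC, ⟨i⟩⟩ | ⟨δ, hδ, l, ⟨i⟩⟩ | ⟨δ, hδ, l, ⟨i⟩⟩
      · exact Or.inl (Connectifier.isCaterpillar_congr e h1)
      · exact Or.inr (Or.inl ⟨n, C, hC, ⟨e.symm.trans i⟩⟩)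
      · exact Or.inr (Or.inr (Or.inl ⟨δ, hδ, l, ⟨e.symm.trans i⟩⟩))
      · exact Or.inr (Or.inr (Or.inr ⟨δ, hδ, l, ⟨e.symm.trans i⟩⟩))
    · rintro _ ⟨z, hz, rfl⟩
      refine ⟨f' z, ⟨⟨z, rfl⟩, hyadj z hz⟩, ?_⟩
      rintro _ ⟨⟨z', rfl⟩, hadj⟩
      exact hyuniq z hz _ (hmem z') hadj
    · rw [Connectifier.image_simplicialVertices_induce_range]
      ext v
      constructor
      · rintro ⟨⟨z', rfl⟩, _, ⟨z, hz, rfl⟩, hadj⟩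
        exact ⟨z, hz, (hyuniq z hz _ (hmem z') hadj).symm⟩
      · rintro ⟨z, hz, rfl⟩
        exact ⟨⟨z, rfl⟩, y z, ⟨z, hz, rfl⟩, hyadj z hz⟩
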